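/- \textbf{Conventions.} Rings and algebras need not have a unit. A generalized Boolean algebra is a distributive lattice with relative complements and a least element $\emptyset$. A \emph{generalized Boolean dynamical system} $(\mathcal B,\mathcal L,\theta,\mathcal I)$ consists of a generalized Boolean algebra $\mathcal B$, a set $\mathcal L$, a morphism of generalized Boolean algebras $\theta_\alpha:\mathcal B\to\mathcal B$ for each $\alpha\in\mathcal L$, and a (non-empty) ideal $\mathcal I_\alpha$ of $\mathcal B$ for each $\alpha\in\mathcal L$ that contains every $A\in\mathcal B$ with $A\subseteq\theta_\alpha(B)$ for some $B\in\mathcal B$. Put $\Delta_A=\{\alpha\in\mathcal L:\theta_\alpha(A)\ne\emptyset\}$; $A$ is \emph{regular} if $0<|\Delta_B|<\infty$ for all $\emptyset\ne B\subseteq A$. For a unital commutative ring $R$, $L_R(\mathcal B,\mathcal L,\theta,\mathcal I)$ is the $R$-algebra generated by symbols $p_A$ ($A\in\mathcal B$) and $s_{\alpha,B},s^*_{\alpha,B}$ ($\alpha\in\mathcal L$, $B\in\mathcal I_\alpha$) subject to \begin{enumerate} \item $p_\emptyset=0$, $p_{A\cap A'}=p_Ap_{A'}$, $p_{A\cup A'}=p_A+p_{A'}-p_{A\cap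 A'}$; \item $p_As_{\alpha,B}=s_{\alpha,B}p_{\theta_\alpha(A)}$, $s^*_{\alpha,B}p_A=p_{\theta_\alpha(A)}s^*_{\alpha,B}$; \item $s^*_{\alpha,B}s_{\alpha',B'}=\delta_{\alpha,\alpha'}p_{B\cap B'}$; \item $s_{\alpha,B}p_{B'}=s_{\alpha,B\cap B'}$, $p_{B'}s^*_{\alpha,B}=s^*_{\alpha,B\cap B'}$ for $B'\in\mathcal B$; \item $p_A=\sum_{\alpha\in\Delta_A}s_{\alpha,\theta_\alpha(A)}s^*_{\alpha,\theta_\alpha(A)}$ for all regular $A$. \end{enumerate} It is $\mathbb Z$-graded with $\deg p_A=0$, $\deg s_{\alpha,B}=1$, $\deg s^*_{\alpha,B}=-1$. For a ring $S$, an \emph{$S$-system} $(P,Q,\psi)$ consists of $S$-bimodules $P,Q$ and an $S$-bimodule homomorphism $\psi:P\otimes_SQ\to S$. Put $\theta_{q,p}(x)=q\,\psi(p\otimes x)$ for $x\in Q$ and $\theta_{p,q}(y)=\psi(y\otimes q)\,p$ for $y\in P$, and let $\mathcal F_P(Q)$ and $\mathcal F_Q(P)$ be the additive groups spanned by the operators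 $\theta_{q,p}$ and $\theta_{p,q}$. Condition (FS): for all finite sets $F\subseteq Q$, $G\subseteq P$ there are $\Theta\in\mathcal F_P(Q)$ and $\Theta'\in\mathcal F_Q(P)$ with $\Theta x=x$ for $x\in F$ and $\Theta'y=y$ for $y\in G$. Let $\Delta(s):Q\to Q$, $x\mapsto sx$. A two-sided ideal $K$ of $S$ is \emph{$\psi$-compatible} if $\Delta(K)\subseteq\mathcal F_P(Q)$, and \emph{faithful} if $K\cap\ker\Delta=0$. The ring $\mathcal O_{(P,Q,\psi)}(K)$ is the universal ring generated by additive images $\sigma(S),T(Q),U(P)$ of $S,Q,P$, with $\sigma$ multiplicative, $T,U$ compatible with both module actions via $\sigma$, $\sigma(\psi(p\otimes q))=U(p)T(q)$, and $\sigma(s)=\sum_iT(q_i)U(p_i)$ whenever $s\in K$ and $\Delta(s)=\sum_i\theta_{q_i,p_i}$; it is $\mathbb Z$-graded with $\sigma(S),T(Q),U(P)$ in degrees $0,1,-1$. If (FS) holds and there is a faithful $\psi$-compatible ideal $K$ containing all others, the \emph{Cuntz--Pimsner ring} $\mathcal O_{(P,Q,\psi)}$ is defined to be $\mathcal O_{(P,Q,\psi)}(K)$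 for this $K$. \textbf{Theorem.} Let $(\mathcal B,\mathcal L,\theta,\mathcal I)$ be a generalized Boolean dynamical system and $R$ a unital commutative ring. Then there exist a subring $S\subseteq L_R(\mathcal B,\mathcal L,\theta,\mathcal I)$ and an $S$-system $(J,I,\psi)$ for which the Cuntz--Pimsner ring $\mathcal O_{(J,I,\psi)}$ is defined, such that $L_R(\mathcal B,\mathcal L,\theta,\mathcal I)$ is isomorphic to $\mathcal O_{(J,I,\psi)}$ as a $\mathbb Z$-graded ring. -/

import Mathlib

/-! ### Non-unital algebras presented by generators and relations -/

/-- The generator `x` in the unital `R`-algebra presented by the relations `rel`. -/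
noncomputable def presentedGen (R : Type*) [CommRing R] {X : Type*}
    (rel : FreeAlgebra R X → FreeAlgebra R X → Prop) (x : X) : RingQuot rel :=
  RingQuot.mkAlgHom R rel (FreeAlgebra.ι R x)

/-- The (not necessarily unital) `R`-algebra generated by the set `X` subject to the relations
`rel`, for relations without constant term. It is realized as the non-unital subalgebra generated
by `X` inside the unital algebra with the same presentation; its universal property among
non-unital algebras is `PresentedAlgebra.existsUnique_lift`. -/
def PresentedAlgebra (R : Type*) [CommRing R] {X : Type*}
    (rel : FreeAlgebra R X → FreeAlgebra R X → Prop) : Type _ :=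
  ↥(NonUnitalAlgebra.adjoin R (Set.range (presentedGen R rel)))

namespace PresentedAlgebra

variable (R : Type*) [CommRing R] {X : Type*} (rel : FreeAlgebra R X → FreeAlgebra R X → Prop)

noncomputable instance : NonUnitalRing (PresentedAlgebra R rel) :=
  inferInstanceAs (NonUnitalRing ↥(NonUnitalAlgebra.adjoin R (Set.range (presentedGen R rel))))

noncomputable instance : Module R (PresentedAlgebra R rel) :=
  inferInstanceAs (Module R ↥(NonUnitalAlgebra.adjoin R (Set.range (presentedGen R rel))))

instance : IsScalarTower R (PresentedAlgebra R rel) (PresentedAlgebra R rel) :=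
  inferInstanceAs (IsScalarTower R ↥(NonUnitalAlgebra.adjoin R (Set.range (presentedGen R rel)))
    ↥(NonUnitalAlgebra.adjoin R (Set.range (presentedGen R rel))))

instance : SMulCommClass R (PresentedAlgebra R rel) (PresentedAlgebra R rel) :=
  inferInstanceAs (SMulCommClass R ↥(NonUnitalAlgebra.adjoin R (Set.range (presentedGen R rel)))
    ↥(NonUnitalAlgebra.adjoin R (Set.range (presentedGen R rel))))

/-- The inclusion into the unital algebra with the same presentation. -/
noncomputable def incl : PresentedAlgebra R rel →ₙₐ[R] RingQuot rel :=
  NonUnitalSubalgebraClass.subtype (NonUnitalAlgebra.adjoin R (Set.range (presentedGen R rel)))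

/-- The generator `x` in the presented non-unital algebra. -/
noncomputable def gen (x : X) : PresentedAlgebra R rel :=
  ⟨presentedGen R rel x, NonUnitalAlgebra.subset_adjoin R ⟨x, rfl⟩⟩

/-- When the generator `x` is given the degree `deg x`, this is the component of degree `n`: the
`R`-span of all products of (one or more) generators whose degrees add up to `n`. -/
noncomputable def component (deg : X → ℤ) (n : ℤ) : AddSubgroup (PresentedAlgebra R rel) :=
  (Submodule.span R {a : RingQuot rel | ∃ l : List X, l ≠ [] ∧ (l.map deg).sum = n ∧
    a = (l.map (presentedGen R rel)).prod}).toAddSubgroup.comap (incl R rel : _ →+ RingQuot rel)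

/-- Universal property: a family `f` in a non-unital algebra `A` that satisfies the relations
(evaluated in the unitization of `A`) extends to exactly one homomorphism. -/
theorem existsUnique_lift {A : Type*} [NonUnitalRing A] [Module R A] [IsScalarTower R A A]
    [SMulCommClass R A A] (f : X → A)
    (hf : ∀ a b, rel a b → FreeAlgebra.lift R (fun x => (f x : Unitization R A)) a =
      FreeAlgebra.lift R (fun x => (f x : Unitization R A)) b) :
    ∃! φ : PresentedAlgebra R rel →ₙₐ[R] A, ∀ x, φ (gen R rel x) = f x := by
  set Ψ : RingQuot rel →ₐ[R] Unitization R A :=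
    RingQuot.liftAlgHom R ⟨FreeAlgebra.lift R (fun x => (f x : Unitization R A)),
      fun {a b} h => hf a b h⟩ with hΨ
  have hgen : ∀ x, Ψ (presentedGen R rel x) = (f x : Unitization R A) := by
    intro x
    rw [hΨ, presentedGen, RingQuot.liftAlgHom_mkAlgHom_apply, FreeAlgebra.lift_ι_apply]
  have hmem : ∀ a ∈ NonUnitalAlgebra.adjoin R (Set.range (presentedGen R rel)),
      ((Ψ a).snd : Unitization R A) = Ψ a := by
    intro a ha
    refine NonUnitalAlgebra.adjoin_induction (p := fun a _ =>
      ((Ψ a).snd : Unitization R A) = Ψ a) ?_ ?_ ?_ ?_ ?_ ha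
    · rintro _ ⟨x, rfl⟩
      rw [hgen, Unitization.snd_inr]
    · intro a b _ _ h1 h2
      rw [map_add, Unitization.snd_add, Unitization.inr_add, h1, h2]
    · simp
    · intro a b _ _ h1 h2
      rw [map_mul, ← h1, ← h2, ← Unitization.inr_mul, Unitization.snd_inr]
    · intro r a _ h
      rw [map_smul, Unitization.snd_smul, Unitization.inr_smul, h]
  refine ⟨{ toFun := fun a => (Ψ (incl R rel a)).snd
            map_smul' := fun r a => by simp
            map_zero' := by simp
            map_add' := fun a b => by simp
            map_mul' := fun a b => ?_ }, ?_, ?_⟩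
  · apply Unitization.inr_injective (R := R)
    rw [Unitization.inr_mul, hmem (incl R rel (a * b)) (a * b).2, hmem (incl R rel a) a.2,
      hmem (incl R rel b) b.2, map_mul, map_mul]
  · intro x
    change (Ψ (presentedGen R rel x)).snd = f x
    rw [hgen, Unitization.snd_inr]
  · intro φ hφ
    ext a
    obtain ⟨a, ha⟩ := a
    refine NonUnitalAlgebra.adjoin_induction (p := fun a ha =>
      φ ⟨a, ha⟩ = (Ψ a).snd) ?_ ?_ ?_ ?_ ?_ ha
    · rintro _ ⟨x, rfl⟩
      rw [hgen, Unitization.snd_inr]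
      exact hφ x
    · intro a b ha hb h1 h2
      refine (map_add φ ⟨a, ha⟩ ⟨b, hb⟩).trans ?_
      rw [h1, h2, map_add, Unitization.snd_add]
    · refine (map_zero φ).trans ?_
      rw [map_zero, Unitization.snd_zero]
    · intro a b ha hb h1 h2
      apply Unitization.inr_injective (R := R)
      rw [hmem _ (mul_mem ha hb), map_mul, ← hmem _ ha, ← hmem _ hb, ← h1, ← h2,
        ← Unitization.inr_mul]
      exact congrArg _ (map_mul φ ⟨a, ha⟩ ⟨b, hb⟩)
    · intro r a ha h
      refine (map_smul φ r ⟨a, ha⟩).trans ?_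
      rw [h, map_smul, Unitization.snd_smul]

end PresentedAlgebra

/-! ### Graded rings and graded isomorphism -/

/-- The subgroups `𝒜 n` make the (possibly non-unital) ring `A` a `ℤ`-graded ring. -/
def IsIntGrading {A : Type*} [NonUnitalRing A] (𝒜 : ℤ → AddSubgroup A) : Prop :=
  DirectSum.IsInternal 𝒜 ∧ ∀ m n : ℤ, ∀ a ∈ 𝒜 m, ∀ b ∈ 𝒜 n, a * b ∈ 𝒜 (m + n)

/-- `A` with `𝒜` and `B` with `ℬ` are `ℤ`-graded rings, and they are graded isomorphic. -/
def GradedIsomorphic {A B : Type*} [NonUnitalRing A] [NonUnitalRing B]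
    (𝒜 : ℤ → AddSubgroup A) (ℬ : ℤ → AddSubgroup B) : Prop :=
  IsIntGrading 𝒜 ∧ IsIntGrading ℬ ∧
    ∃ Φ : A ≃+* B, ∀ n : ℤ, (𝒜 n).map (Φ : A →+ B) = ℬ n

/-! ### Generalized Boolean dynamical systems and their algebras -/

/-- A generalized Boolean dynamical system `(𝓑, Λ, θ, 𝓘)` on the generalized Boolean algebra `𝓑`
with alphabet `Λ`. -/
structure GenBooleanDynSystem (𝓑 : Type*) [GeneralizedBooleanAlgebra 𝓑] (Λ : Type*) where
  /-- The action `θ_α` of the letter `α`, a morphism of generalized Boolean algebras. -/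
  θ : Λ → LatticeHom 𝓑 𝓑
  map_bot : ∀ α, θ α ⊥ = ⊥
  map_sdiff : ∀ α A B, θ α (A \ B) = θ α A \ θ α B
  /-- The ideal `𝓘_α`. -/
  idl : Λ → Order.Ideal 𝓑
  mem_idl_of_le : ∀ α A B, A ≤ θ α B → A ∈ idl α

namespace GenBooleanDynSystem

variable {𝓑 : Type*} [GeneralizedBooleanAlgebra 𝓑] {Λ : Type*}

/-- `Δ_A`, the set of letters that act non-trivially on `A`. -/
def Δ (D : GenBooleanDynSystem 𝓑 Λ) (A : 𝓑) : Set Λ := {α | D.θ α A ≠ ⊥}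

/-- `A` is regular: `0 < |Δ_B| < ∞` for all non-empty `B ⊆ A`. -/
def IsRegular (D : GenBooleanDynSystem 𝓑 Λ) (A : 𝓑) : Prop :=
  ∀ B ≤ A, B ≠ ⊥ → (D.Δ B).Nonempty ∧ (D.Δ B).Finite

/-- The element `θ_α(A)` of `𝓘_α`. -/
def img (D : GenBooleanDynSystem 𝓑 Λ) (α : Λ) (A : 𝓑) : D.idl α :=
  ⟨D.θ α A, D.mem_idl_of_le α _ A le_rfl⟩

/-- The element `B ∩ A` of `𝓘_α`, for `B` in `𝓘_α`. -/
def cut (D : GenBooleanDynSystem 𝓑 Λ) {α : Λ} (B : D.idl α) (A : 𝓑) : D.idl α :=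
  ⟨(B : 𝓑) ⊓ A, (D.idl α).lower inf_le_left B.2⟩

/-- The generating symbols `p_A`, `s_{α,B}` and `s*_{α,B}`, where `B` is in `𝓘_α`. -/
inductive Gen (D : GenBooleanDynSystem 𝓑 Λ)
  | p (A : 𝓑)
  | s (α : Λ) (B : D.idl α)
  | sStar (α : Λ) (B : D.idl α)

/-- `p_A` has degree `0`, `s_{α,B}` has degree `1` and `s*_{α,B}` has degree `-1`. -/
def Gen.deg {D : GenBooleanDynSystem 𝓑 Λ} : D.Gen → ℤ
  | .p _ => 0
  | .s _ _ => 1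
  | .sStar _ _ => -1

variable (R : Type*) [CommRing R] (D : GenBooleanDynSystem 𝓑 Λ)

/-- The symbol `p_A` in the free algebra. -/
def pF (A : 𝓑) : FreeAlgebra R D.Gen := FreeAlgebra.ι R (Gen.p A)

/-- The symbol `s_{α,B}` in the free algebra. -/
def sF (α : Λ) (B : D.idl α) : FreeAlgebra R D.Gen := FreeAlgebra.ι R (Gen.s α B)

/-- The symbol `s*_{α,B}` in the free algebra. -/
def sStarF (α : Λ) (B : D.idl α) : FreeAlgebra R D.Gen := FreeAlgebra.ι R (Gen.sStar α B)

/-- The defining relations of `L_R(𝓑, Λ, θ, 𝓘)`. In `p_regular` the finite set `F` is `Δ_A`. -/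
inductive Rel : FreeAlgebra R D.Gen → FreeAlgebra R D.Gen → Prop
  | p_bot : Rel (D.pF R ⊥) 0
  | p_inf (A A' : 𝓑) : Rel (D.pF R (A ⊓ A')) (D.pF R A * D.pF R A')
  | p_sup (A A' : 𝓑) : Rel (D.pF R (A ⊔ A')) (D.pF R A + D.pF R A' - D.pF R (A ⊓ A'))
  | p_mul_s (A : 𝓑) (α : Λ) (B : D.idl α) :
      Rel (D.pF R A * D.sF R α B) (D.sF R α B * D.pF R (D.θ α A))
  | sStar_mul_p (A : 𝓑) (α : Λ) (B : D.idl α) :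
      Rel (D.sStarF R α B * D.pF R A) (D.pF R (D.θ α A) * D.sStarF R α B)
  | sStar_mul_s (α : Λ) (B B' : D.idl α) :
      Rel (D.sStarF R α B * D.sF R α B') (D.pF R ((B : 𝓑) ⊓ (B' : 𝓑)))
  | sStar_mul_s_of_ne (α α' : Λ) (h : α ≠ α') (B : D.idl α) (B' : D.idl α') :
      Rel (D.sStarF R α B * D.sF R α' B') 0
  | s_mul_p (α : Λ) (B : D.idl α) (B' : 𝓑) :
      Rel (D.sF R α B * D.pF R B') (D.sF R α (D.cut B B'))
  | p_mul_sStar (α : Λ) (B : D.idl α) (B' : 𝓑) :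
      Rel (D.pF R B' * D.sStarF R α B) (D.sStarF R α (D.cut B B'))
  | p_regular (A : 𝓑) (hA : D.IsRegular A) (F : Finset Λ) (hF : (F : Set Λ) = D.Δ A) :
      Rel (D.pF R A) (∑ α ∈ F, D.sF R α (D.img α A) * D.sStarF R α (D.img α A))

/-- The generalized Boolean dynamical system algebra `L_R(𝓑, Λ, θ, 𝓘)`. -/
abbrev BooleanAlg : Type _ := PresentedAlgebra R (D.Rel R)

/-- The homogeneous component of degree `n` of `L_R(𝓑, Λ, θ, 𝓘)`. -/
noncomputable def grading (n : ℤ) : AddSubgroup (D.BooleanAlg R) :=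
  PresentedAlgebra.component R (D.Rel R) Gen.deg n

end GenBooleanDynSystem

/-! ### Systems over a non-unital ring and their Cuntz–Pimsner rings -/

/-- A bimodule over the (possibly non-unital) ring `S`: biadditive left and right actions that are
associative and commute with each other. -/
class NUBimodule (S M : Type*) [NonUnitalRing S] [AddCommGroup M] where
  /-- `lact s m` is `s m`. -/
  lact : S →+ M →+ M
  /-- `ract s m` is `m s`. -/
  ract : S →+ M →+ M
  mul_lact : ∀ s t m, lact (s * t) m = lact s (lact t m)
  mul_ract : ∀ s t m, ract (s * t) m = ract t (ract s m)
  lact_ract : ∀ s t m, lact s (ract t m) = ract t (lact s m)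

open scoped TensorProduct in
/-- The tensor product `P ⊗_S Q`: the quotient of `P ⊗_ℤ Q` by the elements
`p s ⊗ q - p ⊗ s q`. -/
abbrev NUTensor (S P Q : Type*) [NonUnitalRing S] [AddCommGroup P] [AddCommGroup Q]
    [NUBimodule S P] [NUBimodule S Q] : Type _ :=
  (P ⊗[ℤ] Q) ⧸ AddSubgroup.closure {t : P ⊗[ℤ] Q | ∃ (p : P) (s : S) (q : Q),
    t = NUBimodule.ract s p ⊗ₜ[ℤ] q - p ⊗ₜ[ℤ] NUBimodule.lact s q}

open scoped TensorProduct in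
/-- The pure tensor `p ⊗ q` in `P ⊗_S Q`. -/
def NUTensor.tmul (S : Type*) {P Q : Type*} [NonUnitalRing S] [AddCommGroup P] [AddCommGroup Q]
    [NUBimodule S P] [NUBimodule S Q] (p : P) (q : Q) : NUTensor S P Q :=
  QuotientAddGroup.mk (p ⊗ₜ[ℤ] q)

/-- An `S`-system `(P, Q, ψ)`: two `S`-bimodules with an `S`-bimodule homomorphism
`ψ : P ⊗_S Q → S`. As the pure tensors generate `P ⊗_S Q`, with `s (p ⊗ q) = s p ⊗ q` and
`(p ⊗ q) s = p ⊗ q s`, linearity of `ψ` is required on them. -/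
structure RingSystem.{u} (S : Type u) [NonUnitalRing S] where
  P : Type u
  Q : Type u
  [addCommGroupP : AddCommGroup P]
  [addCommGroupQ : AddCommGroup Q]
  [bimoduleP : NUBimodule S P]
  [bimoduleQ : NUBimodule S Q]
  ψ : NUTensor S P Q →+ S
  ψ_lact : ∀ s p q, ψ (NUTensor.tmul S (NUBimodule.lact s p) q) = s * ψ (NUTensor.tmul S p q)
  ψ_ract : ∀ s p q, ψ (NUTensor.tmul S p (NUBimodule.ract s q)) = ψ (NUTensor.tmul S p q) * s

namespace RingSystem

attribute [instance] addCommGroupP addCommGroupQ bimoduleP bimoduleQ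

variable {S : Type*} [NonUnitalRing S] (X : RingSystem S)

/-- The value `ψ(p ⊗ q)`. -/
def pair (p : X.P) (q : X.Q) : S := X.ψ (NUTensor.tmul S p q)

/-- The operator `∑ θ_{q_i, p_i}` on `Q`, where `θ_{q,p}(x) = q ψ(p ⊗ x)`. These are the
elements of `𝓕_P(Q)`. -/
def finRankQ {n : ℕ} (q : Fin n → X.Q) (p : Fin n → X.P) (x : X.Q) : X.Q :=
  ∑ i, NUBimodule.ract (X.pair (p i) x) (q i)

/-- The operator `∑ θ_{p_i, q_i}` on `P`, where `θ_{p,q}(y) = ψ(y ⊗ q) p`. These are the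
elements of `𝓕_Q(P)`. -/
def finRankP {n : ℕ} (q : Fin n → X.Q) (p : Fin n → X.P) (y : X.P) : X.P :=
  ∑ i, NUBimodule.lact (X.pair y (q i)) (p i)

/-- Condition (FS): on any finite sets of elements of `Q` and of `P`, some operators of
`𝓕_P(Q)` and of `𝓕_Q(P)` act as the identity. -/
def ConditionFS : Prop :=
  (∀ F : Finset X.Q, ∃ (n : ℕ) (q : Fin n → X.Q) (p : Fin n → X.P),
      ∀ x ∈ F, X.finRankQ q p x = x) ∧
  (∀ F : Finset X.P, ∃ (n : ℕ) (q : Fin n → X.Q) (p : Fin n → X.P),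
      ∀ y ∈ F, X.finRankP q p y = y)

/-- The ideal `K` of `S` is `ψ`-compatible: each `s` in `K` acts on `Q` from the left by an
operator of `𝓕_P(Q)`. -/
def IsCompatible (K : TwoSidedIdeal S) : Prop :=
  ∀ s ∈ K, ∃ (n : ℕ) (q : Fin n → X.Q) (p : Fin n → X.P),
    ∀ x, NUBimodule.lact s x = X.finRankQ q p x

/-- The ideal `K` of `S` is faithful: only `0` in `K` acts as zero on `Q` from the left. -/
def IsFaithfulIdeal (K : TwoSidedIdeal S) : Prop :=
  ∀ s ∈ K, (∀ x : X.Q, NUBimodule.lact s x = 0) → s = 0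

/-- The generating symbols of the Cuntz–Pimsner ring: the images of `S`, `Q` and `P`. -/
inductive Gen
  | ofS (s : S)
  | ofQ (q : X.Q)
  | ofP (p : X.P)

/-- The images of `S`, `Q` and `P` have the degrees `0`, `1` and `-1`. -/
def Gen.deg {X : RingSystem S} : X.Gen → ℤ
  | .ofS _ => 0
  | .ofQ _ => 1
  | .ofP _ => -1

/-- The symbol for `s` in the free ring. -/
def sF (s : S) : FreeAlgebra ℤ X.Gen := FreeAlgebra.ι ℤ (Gen.ofS s)

/-- The symbol for `q` in the free ring. -/
def qF (q : X.Q) : FreeAlgebra ℤ X.Gen := FreeAlgebra.ι ℤ (Gen.ofQ q)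

/-- The symbol for `p` in the free ring. -/
def pF (p : X.P) : FreeAlgebra ℤ X.Gen := FreeAlgebra.ι ℤ (Gen.ofP p)

/-- The relations of a covariant representation of `(P, Q, ψ)` (all but the last one, which define
the Toeplitz ring) that is Cuntz–Pimsner invariant relative to `K` (the last one: an element
`s` of `K` that acts on `Q` as `∑ θ_{q_i, p_i}` is identified with `∑ q_i p_i`). -/
inductive Rel (K : TwoSidedIdeal S) : FreeAlgebra ℤ X.Gen → FreeAlgebra ℤ X.Gen → Prop
  | s_add (s t : S) : Rel K (X.sF (s + t)) (X.sF s + X.sF t)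
  | s_mul (s t : S) : Rel K (X.sF (s * t)) (X.sF s * X.sF t)
  | q_add (q q' : X.Q) : Rel K (X.qF (q + q')) (X.qF q + X.qF q')
  | p_add (p p' : X.P) : Rel K (X.pF (p + p')) (X.pF p + X.pF p')
  | q_lact (s : S) (q : X.Q) : Rel K (X.qF (NUBimodule.lact s q)) (X.sF s * X.qF q)
  | q_ract (s : S) (q : X.Q) : Rel K (X.qF (NUBimodule.ract s q)) (X.qF q * X.sF s)
  | p_lact (s : S) (p : X.P) : Rel K (X.pF (NUBimodule.lact s p)) (X.sF s * X.pF p)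
  | p_ract (s : S) (p : X.P) : Rel K (X.pF (NUBimodule.ract s p)) (X.pF p * X.sF s)
  | covariance (p : X.P) (q : X.Q) : Rel K (X.sF (X.pair p q)) (X.pF p * X.qF q)
  | invariance (s : S) (hs : s ∈ K) (n : ℕ) (q : Fin n → X.Q) (p : Fin n → X.P)
      (h : ∀ x, NUBimodule.lact s x = X.finRankQ q p x) :
      Rel K (X.sF s) (∑ i, X.qF (q i) * X.pF (p i))

/-- The Cuntz–Pimsner ring `𝓞_{(P,Q,ψ)}(K)` relative to the ideal `K`: the universal ring for
covariant representations that are Cuntz–Pimsner invariant relative to `K`. -/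
abbrev CPRing (K : TwoSidedIdeal S) : Type _ := PresentedAlgebra ℤ (X.Rel K)

/-- The homogeneous component of degree `n` of `𝓞_{(P,Q,ψ)}(K)`. -/
noncomputable def grading (K : TwoSidedIdeal S) (n : ℤ) : AddSubgroup (X.CPRing K) :=
  PresentedAlgebra.component ℤ (X.Rel K) Gen.deg n

/-- The Cuntz–Pimsner ring `𝓞_{(P,Q,ψ)}` is defined and equals `𝓞_{(P,Q,ψ)}(K)`: condition (FS)
holds, and `K` is a faithful `ψ`-compatible ideal that contains all others. -/
def IsCPIdeal (K : TwoSidedIdeal S) : Prop :=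
  X.ConditionFS ∧ IsGreatest {K' : TwoSidedIdeal S | X.IsFaithfulIdeal K' ∧ X.IsCompatible K'} K

end RingSystem

/-!
Let `A` be the Boolean dynamical system algebra and `S = A₀`. The multiplication
`A₋₁ ⊗ A₁ → A₀` is an `A₀`-system, and its Cuntz–Pimsner ideal is `A₁ A₋₁`. The elements
`∑ s_{α,B_α} s*_{α,B_α}` of this ideal act as the identity on finite parts of `A₁` and `A₋₁`, which
gives (FS), faithfulness of the ideal, and a graded homomorphism from the Cuntz–Pimsner ring to
`A`. This homomorphism is surjective because `A` is generated by its components of degrees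
`0, 1, -1`. It is injective because a homogeneous element of the Cuntz–Pimsner ring is brought back
to degree `0`, on which the map is injective, by multiplication with copies of `P` or `Q`.

For the maximality of `A₁ A₋₁`, note that `A₀` is spanned modulo `A₁ A₋₁` by the `p_B`. If `r p_B`
is a non-zero element of a faithful compatible ideal, then faithfulness makes `Δ_C` non-empty and
compatibility makes it finite for each non-empty `C ⊆ B`, so that `B` is regular and
`p_B ∈ A₁ A₋₁` by the last defining relation. This needs `r p_C ≠ 0` for `r ≠ 0` and non-empty `C`,
which is seen in a representation of `A` on functions on the space of boundary paths.
-/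

/-! ### Internal gradings -/

open scoped DirectSum Pointwise

section IntGrading

variable {ι A B : Type*} [DecidableEq ι]

theorem isInternal_of_separating [AddCommGroup A] [AddCommMonoid B] {𝒜 : ι → AddSubgroup A}
    (π : ι → A →+ B) (eq_zero_of_mem : ∀ i, ∀ a ∈ 𝒜 i, π i a = 0 → a = 0)
    (map_eq_zero : ∀ i j, j ≠ i → ∀ a ∈ 𝒜 j, π i a = 0) (iSup_eq_top : ⨆ i, 𝒜 i = ⊤) :
    DirectSum.IsInternal 𝒜 := by
  have π_coe (d : ⨁ i, 𝒜 i) (i : ι) : π i (DirectSum.coeAddMonoidHom 𝒜 d) = π i (d i) := by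
    induction d using DirectSum.induction_on with
    | zero => simp
    | of j a =>
      rw [DirectSum.coeAddMonoidHom_of]
      obtain rfl | hji := eq_or_ne j i
      · rw [DirectSum.of_eq_same]
      · rw [DirectSum.of_eq_of_ne _ _ _ hji.symm, map_eq_zero i j hji a a.2, ZeroMemClass.coe_zero,
          map_zero]
    | add d e hd he => simp only [map_add, hd, he, DirectSum.add_apply, AddSubgroup.coe_add]
  refine ⟨(injective_iff_map_eq_zero _).2 fun d hd => DFinsupp.ext fun i => Subtype.ext ?_, ?_⟩
  · refine eq_zero_of_mem i _ (d i).2 ?_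
    rw [← π_coe, hd, map_zero]
  · rw [← AddMonoidHom.range_eq_top, ← top_le_iff, ← iSup_eq_top, iSup_le_iff]
    exact fun i a ha => ⟨DirectSum.of _ i ⟨a, ha⟩, DirectSum.coeAddMonoidHom_of _ _ _⟩

theorem coe_decompose_map [AddCommGroup A] [AddCommGroup B] {F : Type*} [FunLike F B A]
    [AddMonoidHomClass F B A] (𝒜 : ι → AddSubgroup A) (ℬ : ι → AddSubgroup B)
    [DirectSum.Decomposition 𝒜] [DirectSum.Decomposition ℬ] {φ : F}
    (hφ : ∀ i, ∀ b ∈ ℬ i, φ b ∈ 𝒜 i) (b : B) (i : ι) :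
    (DirectSum.decompose 𝒜 (φ b) i : A) = φ (DirectSum.decompose ℬ b i) := by
  induction b using DirectSum.Decomposition.inductionOn ℬ with
  | zero => simp
  | @homogeneous j b =>
    obtain rfl | hji := eq_or_ne j i
    · rw [DirectSum.decompose_of_mem_same 𝒜 (hφ j b b.2),
        DirectSum.decompose_of_mem_same ℬ b.2]
    · rw [DirectSum.decompose_of_mem_ne 𝒜 (hφ j b b.2) hji,
        DirectSum.decompose_of_mem_ne ℬ b.2 hji, map_zero]
  | add b b' hb hb' =>
    simp only [map_add, DirectSum.decompose_add, DirectSum.add_apply, AddSubgroup.coe_add, hb, hb']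

end IntGrading

theorem gradedIsomorphic_of_surjective {A B : Type*} [NonUnitalRing A] [NonUnitalRing B]
    {𝒜 : ℤ → AddSubgroup A} {ℬ : ℤ → AddSubgroup B} (h𝒜 : IsIntGrading 𝒜) (hℬ : IsIntGrading ℬ)
    (φ : B →ₙ+* A) (map_mem : ∀ n, ∀ b ∈ ℬ n, φ b ∈ 𝒜 n)
    (eq_zero_of_mem : ∀ n, ∀ b ∈ ℬ n, φ b = 0 → b = 0) (surjective : Function.Surjective φ) :
    GradedIsomorphic 𝒜 ℬ := by
  let := h𝒜.1.chooseDecomposition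
  let := hℬ.1.chooseDecomposition
  have injective : Function.Injective φ := by
    refine (injective_iff_map_eq_zero φ).2 fun b hb => ?_
    have decompose_eq_zero : DirectSum.decompose ℬ b = 0 := DFinsupp.ext fun n => Subtype.ext <|
      eq_zero_of_mem n _ (SetLike.coe_mem _) <| by
        rw [← coe_decompose_map 𝒜 ℬ map_mem, hb, DirectSum.decompose_zero]; rfl
    rwa [← DirectSum.decompose_zero (ℳ := ℬ), EmbeddingLike.apply_eq_iff_eq] at decompose_eq_zero
  let Φ : B ≃+* A := RingEquiv.ofBijective φ ⟨injective, surjective⟩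
  refine ⟨h𝒜, hℬ, Φ.symm, fun n => le_antisymm ?_ fun b hb =>
    ⟨φ b, map_mem n b hb, Φ.symm_apply_apply b⟩⟩
  rintro _ ⟨a, ha, rfl⟩
  obtain ⟨b, rfl⟩ := surjective a
  change Φ.symm (Φ b) ∈ ℬ n
  have hb : (DirectSum.decompose ℬ b n : B) = b := injective <| by
    rw [← coe_decompose_map 𝒜 ℬ map_mem, DirectSum.decompose_of_mem_same 𝒜 ha]
  rw [Φ.symm_apply_apply, ← hb]
  exact SetLike.coe_mem _

/-! ### Homogeneous presentations -/

namespace PresentedAlgebra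

variable {R : Type*} [CommRing R] {X : Type*} {rel : FreeAlgebra R X → FreeAlgebra R X → Prop}

theorem incl_injective : Function.Injective (incl R rel) := Subtype.val_injective

@[simp]
theorem incl_gen (x : X) : incl R rel (gen R rel x) = presentedGen R rel x := rfl

theorem adjoin_range_gen : NonUnitalAlgebra.adjoin R (Set.range (gen R rel)) = ⊤ := by
  refine top_le_iff.1 fun a _ => ?_
  have : incl R rel a ∈ (NonUnitalAlgebra.adjoin R (Set.range (gen R rel))).map (incl R rel) := by
    rw [NonUnitalAlgHom.map_adjoin, ← Set.range_comp]
    exact Subtype.property (p := (· ∈ NonUnitalAlgebra.adjoin R (Set.range (presentedGen R rel)))) a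
  obtain ⟨b, hb, hab⟩ := this
  exact incl_injective hab ▸ hb

/-- The span of the nonempty words of degree `n` in the unital algebra with the same presentation;
`component` is its preimage under `incl`. -/
noncomputable def wordSpan (rel : FreeAlgebra R X → FreeAlgebra R X → Prop) (deg : X → ℤ) (n : ℤ) :
    Submodule R (RingQuot rel) :=
  Submodule.span R {a : RingQuot rel | ∃ l : List X, l ≠ [] ∧ (l.map deg).sum = n ∧
    a = (l.map (presentedGen R rel)).prod}

theorem mem_component {deg : X → ℤ} {n : ℤ} {a : PresentedAlgebra R rel} :
    a ∈ component R rel deg n ↔ incl R rel a ∈ wordSpan rel deg n := Iff.rfl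

theorem gen_mem_component (deg : X → ℤ) (x : X) : gen R rel x ∈ component R rel deg (deg x) :=
  Submodule.subset_span ⟨[x], by simp⟩

theorem smul_mem_component {deg : X → ℤ} {n : ℤ} (r : R) {a : PresentedAlgebra R rel}
    (ha : a ∈ component R rel deg n) : r • a ∈ component R rel deg n := by
  rw [mem_component, map_smul]
  exact Submodule.smul_mem _ r ha

theorem mul_mem_component {deg : X → ℤ} {m n : ℤ} {a b : PresentedAlgebra R rel}
    (ha : a ∈ component R rel deg m) (hb : b ∈ component R rel deg n) :
    a * b ∈ component R rel deg (m + n) := by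
  have wordSpan_mul_le : wordSpan rel deg m * wordSpan rel deg n ≤ wordSpan rel deg (m + n) := by
    rw [wordSpan, wordSpan, Submodule.span_mul_span]
    refine Submodule.span_mono ?_
    rintro _ ⟨_, ⟨l, hl, rfl, rfl⟩, _, ⟨l', -, rfl, rfl⟩, rfl⟩
    exact ⟨l ++ l', by simp [hl]⟩
  rw [mem_component, map_mul]
  exact wordSpan_mul_le (Submodule.mul_mem_mul ha hb)

theorem component_le {deg : X → ℤ} {𝒩 : ℤ → Submodule R (PresentedAlgebra R rel)}
    (gen_mem : ∀ x, gen R rel x ∈ 𝒩 (deg x))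
    (gen_mul_mem : ∀ x n, ∀ a ∈ 𝒩 n, gen R rel x * a ∈ 𝒩 (deg x + n)) (n : ℤ) :
    component R rel deg n ≤ (𝒩 n).toAddSubgroup := by
  have word_mem (l : List X) (hl : l ≠ []) :
      (l.map (presentedGen R rel)).prod ∈
        (𝒩 (l.map deg).sum).map (incl R rel : _ →ₗ[R] RingQuot rel) := by
    induction l with
    | nil => exact absurd rfl hl
    | cons x l ih =>
      rcases eq_or_ne l [] with rfl | hl'
      · exact ⟨gen R rel x, by simpa using gen_mem x, by simp⟩
      · obtain ⟨a, ha, hal⟩ := ih hl'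
        exact ⟨gen R rel x * a, by simpa using gen_mul_mem x _ a ha, by simp [← hal]⟩
  intro a ha
  have : wordSpan rel deg n ≤ (𝒩 n).map (incl R rel : _ →ₗ[R] RingQuot rel) :=
    Submodule.span_le.2 <| by
      rintro _ ⟨l, hl, rfl, rfl⟩
      exact word_mem l hl
  obtain ⟨b, hb, hba⟩ := this ha
  exact incl_injective hba ▸ hb

theorem iSup_component (deg : X → ℤ) : ⨆ n, component R rel deg n = ⊤ := by
  refine top_le_iff.1 fun a _ => ?_
  have ha : a ∈ Submodule.span R (Subsemigroup.closure (Set.range (gen R rel)) : Set _) := by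
    rw [← NonUnitalAlgebra.adjoin_eq_span, adjoin_range_gen]
    trivial
  have exists_mem_component : ∀ w ∈ Subsemigroup.closure (Set.range (gen R rel)),
      ∃ n, w ∈ component R rel deg n := by
    intro w hw
    induction hw using Subsemigroup.closure_induction with
    | mem _ hx =>
      obtain ⟨x, rfl⟩ := hx
      exact ⟨deg x, gen_mem_component deg x⟩
    | mul _ _ _ _ hv hw =>
      obtain ⟨m, hv⟩ := hv
      obtain ⟨n, hw⟩ := hw
      exact ⟨m + n, mul_mem_component hv hw⟩
  induction ha using Submodule.closure_induction with
  | zero => exact zero_mem _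
  | add a b _ _ ha hb => exact add_mem (ha trivial) (hb trivial)
  | smul_mem r w hw =>
    obtain ⟨n, hn⟩ := exists_mem_component w hw
    exact AddSubgroup.mem_iSup_of_mem n (smul_mem_component r hn)

/-- The homogeneous elements of degree `n` of the free algebra, when the generator `x` has degree
`deg x`. -/
def freeComponent (R : Type*) [CommRing R] {X : Type*} (deg : X → ℤ) (n : ℤ) :
    Submodule R (FreeAlgebra R X) :=
  Submodule.span R {a | ∃ l : List X, (l.map deg).sum = n ∧ a = (l.map (FreeAlgebra.ι R)).prod}

theorem ι_mem_freeComponent {deg : X → ℤ} {n : ℤ} (x : X) (h : deg x = n) :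
    FreeAlgebra.ι R x ∈ freeComponent R deg n :=
  Submodule.subset_span ⟨[x], by simpa using h, by simp⟩

theorem ι_mul_ι_mem_freeComponent {deg : X → ℤ} {n : ℤ} (x y : X) (h : deg x + deg y = n) :
    FreeAlgebra.ι R x * FreeAlgebra.ι R y ∈ freeComponent R deg n :=
  Submodule.subset_span ⟨[x, y], by simpa using h, by simp⟩

/-- The homomorphism from the free algebra that sends `x` to the class of `x` times the monomial of
exponent `deg x`: it records degrees. -/
noncomputable def freeCoaction (rel : FreeAlgebra R X → FreeAlgebra R X → Prop) (deg : X → ℤ) :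
    FreeAlgebra R X →ₐ[R] AddMonoidAlgebra (RingQuot rel) ℤ :=
  FreeAlgebra.lift R fun x => .single (deg x) (presentedGen R rel x)

theorem freeCoaction_of_mem {deg : X → ℤ} {n : ℤ} {a : FreeAlgebra R X}
    (ha : a ∈ freeComponent R deg n) :
    freeCoaction rel deg a = .single n (RingQuot.mkAlgHom R rel a) := by
  have freeCoaction_word (l : List X) : freeCoaction rel deg (l.map (FreeAlgebra.ι R)).prod =
      .single (l.map deg).sum (RingQuot.mkAlgHom R rel (l.map (FreeAlgebra.ι R)).prod) := by
    induction l with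
    | nil =>
      simp only [List.map_nil, List.prod_nil, List.sum_nil, map_one, AddMonoidAlgebra.one_def]
    | cons x l ih =>
      rw [List.map_cons, List.prod_cons, List.map_cons, List.sum_cons, map_mul, map_mul, ih,
        freeCoaction, FreeAlgebra.lift_ι_apply, AddMonoidAlgebra.single_mul_single, presentedGen]
  have : freeComponent R deg n ≤ LinearMap.eqLocus (freeCoaction rel deg).toLinearMap
      (AddMonoidAlgebra.lsingle n ∘ₗ (RingQuot.mkAlgHom R rel).toLinearMap) :=
    Submodule.span_le.2 <| by
      rintro _ ⟨l, rfl, rfl⟩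
      exact freeCoaction_word l
  exact this ha

theorem exists_coaction {deg : X → ℤ}
    (homogeneous : ∀ a b, rel a b → ∃ n, a ∈ freeComponent R deg n ∧ b ∈ freeComponent R deg n) :
    ∃ Ψ : RingQuot rel →ₐ[R] AddMonoidAlgebra (RingQuot rel) ℤ,
      ∀ n, ∀ a ∈ component R rel deg n, Ψ (incl R rel a) = .single n (incl R rel a) := by
  let Ψ : RingQuot rel →ₐ[R] AddMonoidAlgebra (RingQuot rel) ℤ :=
    RingQuot.liftAlgHom R ⟨freeCoaction rel deg, fun a b hab => by
      obtain ⟨n, ha, hb⟩ := homogeneous a b hab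
      rw [freeCoaction_of_mem ha, freeCoaction_of_mem hb, RingQuot.mkAlgHom_rel R hab]⟩
  have Ψ_gen (x : X) : Ψ (presentedGen R rel x) = .single (deg x) (presentedGen R rel x) := by
    rw [presentedGen, RingQuot.liftAlgHom_mkAlgHom_apply, freeCoaction, FreeAlgebra.lift_ι_apply,
      presentedGen]
  let 𝒩 (n : ℤ) : Submodule R (PresentedAlgebra R rel) := LinearMap.eqLocus
    (Ψ.toLinearMap ∘ₗ (incl R rel : _ →ₗ[R] RingQuot rel))
    (AddMonoidAlgebra.lsingle n ∘ₗ (incl R rel : _ →ₗ[R] RingQuot rel))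
  have gen_mul_mem (x : X) (n : ℤ) (a) (ha : a ∈ 𝒩 n) : gen R rel x * a ∈ 𝒩 (deg x + n) := by
    change Ψ (incl R rel a) = .single n (incl R rel a) at ha
    change Ψ (incl R rel (gen R rel x * a)) = .single _ (incl R rel (gen R rel x * a))
    rw [map_mul, incl_gen, map_mul, Ψ_gen, ha, AddMonoidAlgebra.single_mul_single]
  exact ⟨Ψ, fun n a ha => component_le (𝒩 := 𝒩) Ψ_gen gen_mul_mem n ha⟩

theorem isIntGrading_component {deg : X → ℤ}
    (homogeneous : ∀ a b, rel a b → ∃ n, a ∈ freeComponent R deg n ∧ b ∈ freeComponent R deg n) :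
    IsIntGrading (component R rel deg) := by
  obtain ⟨Ψ, hΨ⟩ := exists_coaction homogeneous
  let coeff (n : ℤ) : PresentedAlgebra R rel →+ RingQuot rel :=
    { toFun a := (Ψ (incl R rel a)).coeff n
      map_zero' := by simp
      map_add' := by simp }
  refine ⟨isInternal_of_separating coeff (fun n a ha h => incl_injective ?_)
    (fun n m hmn a ha => ?_) (iSup_component deg), fun m n a ha b hb => mul_mem_component ha hb⟩
  · change (Ψ (incl R rel a)).coeff n = 0 at h
    rwa [hΨ n a ha, AddMonoidAlgebra.coeff_single, Finsupp.single_eq_same] at h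
  · change (Ψ (incl R rel a)).coeff n = 0
    rw [hΨ m a ha, AddMonoidAlgebra.coeff_single, Finsupp.single_eq_of_ne hmn.symm]

end PresentedAlgebra

/-! ### Cuntz–Pimsner rings -/

theorem addSubgroup_mul_assoc {A : Type*} [NonUnitalRing A] (M N P : AddSubgroup A) :
    M * N * P = M * (N * P) :=
  AddSubgroup.toAddSubmonoid_injective
    (mul_assoc M.toAddSubmonoid N.toAddSubmonoid P.toAddSubmonoid)

theorem addSubgroup_mul_le_mul {A : Type*} [NonUnitalRing A] {M N P Q : AddSubgroup A}
    (hMP : M ≤ P) (hNQ : N ≤ Q) : M * N ≤ P * Q :=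
  AddSubmonoid.mul_le_mul hMP hNQ

theorem range_mul_range_le {A M N : Type*} [NonUnitalRing A] [AddGroup M] [AddGroup N]
    {f : M →+ A} {g : N →+ A} {P : AddSubgroup A} (h : ∀ m n, f m * g n ∈ P) :
    f.range * g.range ≤ P :=
  AddSubmonoid.mul_le.2 <| by
    rintro _ ⟨m, rfl⟩ _ ⟨n, rfl⟩
    exact h m n

theorem int_smul_mem {A : Type*} [AddCommGroup A] [Module ℤ A] (M : AddSubgroup A) (r : ℤ) {a : A}
    (ha : a ∈ M) : r • a ∈ M := by
  simpa only [int_smul_eq_zsmul] using zsmul_mem ha r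

namespace RingSystem

variable {S : Type*} [NonUnitalRing S] {X : RingSystem S}

/-- A covariant representation of the system `X` in the ring `A` that is Cuntz–Pimsner invariant
relative to `K`: the data that define homomorphisms from `X.CPRing K` to `A`. -/
structure InvariantRep (X : RingSystem S) (K : TwoSidedIdeal S) (A : Type*)
    [NonUnitalRing A] where
  σ : S →ₙ+* A
  T : X.Q →+ A
  U : X.P →+ A
  T_lact : ∀ s q, T (NUBimodule.lact s q) = σ s * T q
  T_ract : ∀ s q, T (NUBimodule.ract s q) = T q * σ s
  U_lact : ∀ s p, U (NUBimodule.lact s p) = σ s * U p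
  U_ract : ∀ s p, U (NUBimodule.ract s p) = U p * σ s
  σ_pair : ∀ p q, σ (X.pair p q) = U p * T q
  σ_eq_sum : ∀ s ∈ K, ∀ (n : ℕ) (q : Fin n → X.Q) (p : Fin n → X.P),
    (∀ x, NUBimodule.lact s x = X.finRankQ q p x) → σ s = ∑ i, T (q i) * U (p i)

section Universal

variable {K : TwoSidedIdeal S}

theorem InvariantRep.exists_lift {A : Type*} [NonUnitalRing A] (ρ : X.InvariantRep K A) :
    ∃ φ : X.CPRing K →ₙ+* A, (∀ s, φ (PresentedAlgebra.gen ℤ _ (.ofS s)) = ρ.σ s) ∧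
      (∀ q, φ (PresentedAlgebra.gen ℤ _ (.ofQ q)) = ρ.T q) ∧
      ∀ p, φ (PresentedAlgebra.gen ℤ _ (.ofP p)) = ρ.U p := by
  have inr_sum (n : ℕ) (f : Fin n → A) : ((∑ i, f i : A) : Unitization ℤ A) =
      ∑ i, (f i : Unitization ℤ A) :=
    map_sum (Unitization.inrNonUnitalAlgHom ℤ A) f Finset.univ
  obtain ⟨φ, hφ, -⟩ := PresentedAlgebra.existsUnique_lift ℤ (X.Rel K)
    (fun g : X.Gen => match g with
      | .ofS s => ρ.σ s
      | .ofQ q => ρ.T q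
      | .ofP p => ρ.U p) (by
    intro a b h
    cases h <;> simp only [sF, qF, pF, map_add, map_mul, map_sum, FreeAlgebra.lift_ι_apply,
      ← Unitization.inr_add, ← Unitization.inr_mul, ← inr_sum, ρ.T_lact, ρ.T_ract, ρ.U_lact,
      ρ.U_ract, ρ.σ_pair]
    case invariance s hs n q p h => rw [ρ.σ_eq_sum s hs n q p h])
  exact ⟨φ, fun s => hφ (.ofS s), fun q => hφ (.ofQ q), fun p => hφ (.ofP p)⟩

open PresentedAlgebra in
/-- The universal covariant representation that is Cuntz–Pimsner invariant relative to `K`. -/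
noncomputable def universalRep (X : RingSystem S) (K : TwoSidedIdeal S) :
    X.InvariantRep K (X.CPRing K) :=
  have rel_mul {a b c : X.Gen} (h : X.Rel K (.ι ℤ a) (.ι ℤ b * .ι ℤ c)) :
      gen ℤ (X.Rel K) a = gen ℤ _ b * gen ℤ _ c :=
    incl_injective ((RingQuot.mkAlgHom_rel ℤ h).trans (map_mul _ _ _))
  have rel_add {a b c : X.Gen} (h : X.Rel K (.ι ℤ a) (.ι ℤ b + .ι ℤ c)) :
      gen ℤ (X.Rel K) a = gen ℤ _ b + gen ℤ _ c :=
    incl_injective ((RingQuot.mkAlgHom_rel ℤ h).trans (map_add _ _ _))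
  have σ_add (s t : S) := rel_add (.s_add s t)
  { σ :=
      { toFun s := gen ℤ (X.Rel K) (.ofS s)
        map_mul' s t := rel_mul (.s_mul s t)
        map_zero' := by simpa only [add_zero, left_eq_add] using σ_add 0 0
        map_add' := σ_add }
    T := AddMonoidHom.mk' (fun q => gen ℤ (X.Rel K) (.ofQ q)) fun q q' => rel_add (.q_add q q')
    U := AddMonoidHom.mk' (fun p => gen ℤ (X.Rel K) (.ofP p)) fun p p' => rel_add (.p_add p p')
    T_lact s q := rel_mul (.q_lact s q)
    T_ract s q := rel_mul (.q_ract s q)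
    U_lact s p := rel_mul (.p_lact s p)
    U_ract s p := rel_mul (.p_ract s p)
    σ_pair p q := rel_mul (.covariance p q)
    σ_eq_sum s hs n q p h := PresentedAlgebra.incl_injective <| by
      refine (RingQuot.mkAlgHom_rel ℤ (Rel.invariance s hs n q p h)).trans ?_
      simp only [map_sum, map_mul]
      rfl }

open PresentedAlgebra in
theorem isIntGrading_grading (X : RingSystem S) (K : TwoSidedIdeal S) :
    IsIntGrading (X.grading K) := by
  refine isIntGrading_component fun a b h => ?_
  cases h with
  | s_add s t | p_add s t | q_add s t =>
    exact ⟨_, ι_mem_freeComponent _ rfl, add_mem (ι_mem_freeComponent _ rfl)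
      (ι_mem_freeComponent _ rfl)⟩
  | s_mul | q_lact | q_ract | p_lact | p_ract | covariance =>
    exact ⟨_, ι_mem_freeComponent _ rfl, ι_mul_ι_mem_freeComponent _ _ rfl⟩
  | invariance =>
    exact ⟨_, ι_mem_freeComponent _ rfl, sum_mem fun i _ => ι_mul_ι_mem_freeComponent _ _ rfl⟩

end Universal

namespace InvariantRep

variable {K : TwoSidedIdeal S} {A : Type*} [NonUnitalRing A] (ρ : X.InvariantRep K A)

/-- The additive group `σ(S)`. -/
def rangeσ : AddSubgroup A := (ρ.σ : S →+ A).range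

theorem rangeσ_mul_range_T : ρ.rangeσ * ρ.T.range ≤ ρ.T.range :=
  range_mul_range_le fun s q => ⟨_, ρ.T_lact s q⟩

theorem range_T_mul_rangeσ : ρ.T.range * ρ.rangeσ ≤ ρ.T.range :=
  range_mul_range_le fun q s => ⟨_, ρ.T_ract s q⟩

theorem range_U_mul_rangeσ : ρ.U.range * ρ.rangeσ ≤ ρ.U.range :=
  range_mul_range_le fun p s => ⟨_, ρ.U_ract s p⟩

theorem rangeσ_mul_rangeσ : ρ.rangeσ * ρ.rangeσ ≤ ρ.rangeσ :=
  range_mul_range_le fun s t => ⟨_, map_mul ρ.σ s t⟩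

theorem range_U_mul_range_T : ρ.U.range * ρ.T.range ≤ ρ.rangeσ :=
  range_mul_range_le fun p q => ⟨_, ρ.σ_pair p q⟩

theorem T_finRankQ {n : ℕ} (q : Fin n → X.Q) (p : Fin n → X.P) (x : X.Q) :
    ρ.T (X.finRankQ q p x) = ∑ i, ρ.T (q i) * (ρ.U (p i) * ρ.T x) := by
  simp only [finRankQ, map_sum, ρ.T_ract, ρ.σ_pair]

theorem U_finRankP {n : ℕ} (q : Fin n → X.Q) (p : Fin n → X.P) (y : X.P) :
    ρ.U (X.finRankP q p y) = ∑ i, ρ.U y * ρ.T (q i) * ρ.U (p i) := by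
  simp only [finRankP, map_sum, ρ.U_lact, ρ.σ_pair]

theorem exists_sum_T_mul_U_mul (hX : X.ConditionFS) {N : AddSubgroup A} {a : A}
    (ha : a ∈ ρ.T.range * N) :
    ∃ (n : ℕ) (q : Fin n → X.Q) (p : Fin n → X.P), ∑ i, ρ.T (q i) * (ρ.U (p i) * a) = a := by
  classical
  obtain ⟨F, hF⟩ : ∃ F : Finset X.Q, ∀ (n : ℕ) (q : Fin n → X.Q) (p : Fin n → X.P),
      (∀ x ∈ F, X.finRankQ q p x = x) → ∑ i, ρ.T (q i) * (ρ.U (p i) * a) = a := by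
    refine AddSubmonoid.mul_induction_on ha ?_ ?_
    · rintro _ ⟨x, rfl⟩ b -
      refine ⟨{x}, fun n q p h => ?_⟩
      simp only [← mul_assoc _ _ b, ← Finset.sum_mul]
      rw [← ρ.T_finRankQ, h x (Finset.mem_singleton_self x)]
    · rintro a b ⟨F, hF⟩ ⟨G, hG⟩
      refine ⟨F ∪ G, fun n q p h => ?_⟩
      simp only [mul_add, Finset.sum_add_distrib]
      rw [hF n q p fun x hx => h x (Finset.mem_union_left _ hx),
        hG n q p fun x hx => h x (Finset.mem_union_right _ hx)]
  obtain ⟨n, q, p, h⟩ := hX.1 F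
  exact ⟨n, q, p, hF n q p h⟩

theorem exists_sum_mul_T_mul_U (hX : X.ConditionFS) {N : AddSubgroup A} {a : A}
    (ha : a ∈ N * ρ.U.range) :
    ∃ (n : ℕ) (q : Fin n → X.Q) (p : Fin n → X.P), ∑ i, a * ρ.T (q i) * ρ.U (p i) = a := by
  classical
  obtain ⟨F, hF⟩ : ∃ F : Finset X.P, ∀ (n : ℕ) (q : Fin n → X.Q) (p : Fin n → X.P),
      (∀ y ∈ F, X.finRankP q p y = y) → ∑ i, a * ρ.T (q i) * ρ.U (p i) = a := by
    refine AddSubmonoid.mul_induction_on ha ?_ ?_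
    · rintro b - _ ⟨y, rfl⟩
      refine ⟨{y}, fun n q p h => ?_⟩
      simp only [mul_assoc b, ← Finset.mul_sum]
      rw [← ρ.U_finRankP, h y (Finset.mem_singleton_self y)]
    · rintro a b ⟨F, hF⟩ ⟨G, hG⟩
      refine ⟨F ∪ G, fun n q p h => ?_⟩
      simp only [add_mul, Finset.sum_add_distrib]
      rw [hF n q p fun x hx => h x (Finset.mem_union_left _ hx),
        hG n q p fun x hx => h x (Finset.mem_union_right _ hx)]
  obtain ⟨n, q, p, h⟩ := hX.2 F
  exact ⟨n, q, p, hF n q p h⟩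

theorem range_T_le (hX : X.ConditionFS) : ρ.T.range ≤ ρ.T.range * ρ.rangeσ := by
  rintro _ ⟨x, rfl⟩
  obtain ⟨n, q, p, h⟩ := hX.1 {x}
  rw [← h x (Finset.mem_singleton_self x), T_finRankQ]
  exact sum_mem fun i _ => AddSubmonoid.mul_mem_mul ⟨_, rfl⟩ ⟨_, ρ.σ_pair (p i) x⟩

theorem range_U_le (hX : X.ConditionFS) : ρ.U.range ≤ ρ.rangeσ * ρ.U.range := by
  rintro _ ⟨y, rfl⟩
  obtain ⟨n, q, p, h⟩ := hX.2 {y}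
  rw [← h y (Finset.mem_singleton_self y), U_finRankP]
  exact sum_mem fun i _ => AddSubmonoid.mul_mem_mul ⟨_, ρ.σ_pair y (q i)⟩ ⟨_, rfl⟩

/-- The additive group `T(Q)ⁿ σ(S)`. -/
def qPow : ℕ → AddSubgroup A
  | 0 => ρ.rangeσ
  | n + 1 => ρ.T.range * qPow n

/-- The additive group `σ(S) U(P)ⁿ`. -/
def pPow : ℕ → AddSubgroup A
  | 0 => ρ.rangeσ
  | n + 1 => pPow n * ρ.U.range

/-- The additive group `T(Q)ⁿ σ(S)` in degree `n ≥ 0` and `σ(S) U(P)ⁿ` in degree `-n ≤ 0`. -/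
def power : ℤ → AddSubgroup A
  | .ofNat n => ρ.qPow n
  | .negSucc n => ρ.pPow (n + 1)

theorem power_neg_natCast (n : ℕ) : ρ.power (-n) = ρ.pPow n := by
  cases n <;> rfl

theorem rangeσ_mul_qPow (n : ℕ) : ρ.rangeσ * ρ.qPow n ≤ ρ.qPow n := by
  cases n with
  | zero => exact ρ.rangeσ_mul_rangeσ
  | succ n =>
    rw [qPow, ← addSubgroup_mul_assoc]
    exact addSubgroup_mul_le_mul ρ.rangeσ_mul_range_T le_rfl

theorem rangeσ_mul_pPow (n : ℕ) : ρ.rangeσ * ρ.pPow n ≤ ρ.pPow n := by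
  induction n with
  | zero => exact ρ.rangeσ_mul_rangeσ
  | succ n ih =>
    rw [pPow, ← addSubgroup_mul_assoc]
    exact addSubgroup_mul_le_mul ih le_rfl

theorem pPow_mul_rangeσ (n : ℕ) : ρ.pPow n * ρ.rangeσ ≤ ρ.pPow n := by
  cases n with
  | zero => exact ρ.rangeσ_mul_rangeσ
  | succ n =>
    rw [pPow, addSubgroup_mul_assoc]
    exact addSubgroup_mul_le_mul le_rfl ρ.range_U_mul_rangeσ

theorem range_U_mul_qPow_succ (n : ℕ) : ρ.U.range * ρ.qPow (n + 1) ≤ ρ.qPow n := by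
  rw [qPow, ← addSubgroup_mul_assoc]
  exact (addSubgroup_mul_le_mul ρ.range_U_mul_range_T le_rfl).trans (ρ.rangeσ_mul_qPow n)

theorem pPow_succ_mul_range_T (n : ℕ) : ρ.pPow (n + 1) * ρ.T.range ≤ ρ.pPow n := by
  rw [pPow, addSubgroup_mul_assoc]
  exact (addSubgroup_mul_le_mul le_rfl ρ.range_U_mul_range_T).trans (ρ.pPow_mul_rangeσ n)

theorem range_U_mul_pPow (hX : X.ConditionFS) (n : ℕ) :
    ρ.U.range * ρ.pPow n ≤ ρ.pPow (n + 1) := by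
  induction n with
  | zero => exact ρ.range_U_mul_rangeσ.trans (ρ.range_U_le hX)
  | succ n ih =>
    rw [pPow, ← addSubgroup_mul_assoc]
    exact addSubgroup_mul_le_mul ih le_rfl

variable {ρ} in
theorem range_T_mul_pPow_succ (hρ : ρ.T.range * ρ.U.range ≤ ρ.rangeσ) (n : ℕ) :
    ρ.T.range * ρ.pPow (n + 1) ≤ ρ.pPow n := by
  induction n with
  | zero =>
    change ρ.T.range * (ρ.rangeσ * ρ.U.range) ≤ ρ.rangeσ
    rw [← addSubgroup_mul_assoc]
    exact (addSubgroup_mul_le_mul ρ.range_T_mul_rangeσ le_rfl).trans hρ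
  | succ n ih =>
    rw [pPow, ← addSubgroup_mul_assoc]
    exact addSubgroup_mul_le_mul ih le_rfl

theorem rangeσ_mul_power (n : ℤ) : ρ.rangeσ * ρ.power n ≤ ρ.power (0 + n) := by
  rw [zero_add]
  cases n with
  | ofNat n => exact ρ.rangeσ_mul_qPow n
  | negSucc n => exact ρ.rangeσ_mul_pPow (n + 1)

variable {ρ} in
theorem range_T_mul_power (hρ : ρ.T.range * ρ.U.range ≤ ρ.rangeσ) (n : ℤ) :
    ρ.T.range * ρ.power n ≤ ρ.power (1 + n) := by
  cases n with
  | ofNat n =>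
    rw [add_comm]
    exact le_rfl
  | negSucc n =>
    rw [show 1 + Int.negSucc n = -(n : ℤ) by lia, power_neg_natCast]
    exact range_T_mul_pPow_succ hρ n

theorem range_U_mul_power (hX : X.ConditionFS) (n : ℤ) :
    ρ.U.range * ρ.power n ≤ ρ.power (-1 + n) := by
  cases n with
  | ofNat n =>
    cases n with
    | zero => exact ρ.range_U_mul_pPow hX 0
    | succ n =>
      rw [show -1 + Int.ofNat (n + 1) = Int.ofNat n by lia]
      exact ρ.range_U_mul_qPow_succ n
  | negSucc n =>
    rw [show -1 + Int.negSucc n = Int.negSucc (n + 1) by lia]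
    exact ρ.range_U_mul_pPow hX (n + 1)

section GradedUniqueness

variable {ρ} {B : Type*} [NonUnitalRing B] {φ : A →ₙ+* B}

theorem eq_zero_of_mem_qPow (hX : X.ConditionFS) (hφ : ∀ s, φ (ρ.σ s) = 0 → s = 0) (n : ℕ)
    {a : A} (ha : a ∈ ρ.qPow n) (ha' : φ a = 0) : a = 0 := by
  induction n generalizing a with
  | zero =>
    obtain ⟨s, rfl⟩ := ha
    exact (congrArg ρ.σ (hφ s ha')).trans (map_zero ρ.σ)
  | succ n ih =>
    obtain ⟨m, q, p, ha_eq⟩ := ρ.exists_sum_T_mul_U_mul hX ha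
    rw [← ha_eq]
    refine Finset.sum_eq_zero fun i _ => ?_
    rw [ih (ρ.range_U_mul_qPow_succ n (AddSubmonoid.mul_mem_mul ⟨p i, rfl⟩ ha))
      (by rw [map_mul, ha', mul_zero]), mul_zero]

theorem eq_zero_of_mem_pPow (hX : X.ConditionFS) (hφ : ∀ s, φ (ρ.σ s) = 0 → s = 0) (n : ℕ)
    {a : A} (ha : a ∈ ρ.pPow n) (ha' : φ a = 0) : a = 0 := by
  induction n generalizing a with
  | zero => exact eq_zero_of_mem_qPow hX hφ 0 ha ha'
  | succ n ih =>
    obtain ⟨m, q, p, ha_eq⟩ := ρ.exists_sum_mul_T_mul_U hX ha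
    rw [← ha_eq]
    refine Finset.sum_eq_zero fun i _ => ?_
    rw [ih (ρ.pPow_succ_mul_range_T n (AddSubmonoid.mul_mem_mul ha ⟨q i, rfl⟩))
      (by rw [map_mul, ha', zero_mul]), zero_mul]

theorem eq_zero_of_mem_power (hX : X.ConditionFS) (hφ : ∀ s, φ (ρ.σ s) = 0 → s = 0) (n : ℤ)
    {a : A} (ha : a ∈ ρ.power n) (ha' : φ a = 0) : a = 0 := by
  cases n with
  | ofNat n => exact eq_zero_of_mem_qPow hX hφ n ha ha'
  | negSucc n => exact eq_zero_of_mem_pPow hX hφ (n + 1) ha ha'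

end GradedUniqueness

end InvariantRep

theorem grading_le_power {K : TwoSidedIdeal S} (hX : X.ConditionFS)
    (hTU : (X.universalRep K).T.range * (X.universalRep K).U.range ≤ (X.universalRep K).rangeσ)
    (n : ℤ) : X.grading K n ≤ (X.universalRep K).power n := by
  refine PresentedAlgebra.component_le
    (𝒩 := fun n => { (X.universalRep K).power n with smul_mem' := fun r _ => int_smul_mem _ r })
    ?_ ?_ n
  · rintro (s | q | p)
    · exact ⟨s, rfl⟩
    · exact (X.universalRep K).range_T_le hX ⟨q, rfl⟩
    · exact (X.universalRep K).range_U_le hX ⟨p, rfl⟩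
  · rintro (s | q | p) n a ha
    · exact (X.universalRep K).rangeσ_mul_power n (AddSubmonoid.mul_mem_mul ⟨s, rfl⟩ ha)
    · exact InvariantRep.range_T_mul_power hTU n (AddSubmonoid.mul_mem_mul ⟨q, rfl⟩ ha)
    · exact (X.universalRep K).range_U_mul_power hX n (AddSubmonoid.mul_mem_mul ⟨p, rfl⟩ ha)

end RingSystem

/-! ### The system of a graded ring -/

open scoped TensorProduct in
/-- The homomorphism on `P ⊗_S Q` induced by a balanced biadditive map. -/
def NUTensor.lift {S P Q M : Type*} [NonUnitalRing S] [AddCommGroup P] [AddCommGroup Q]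
    [AddCommGroup M] [NUBimodule S P] [NUBimodule S Q] (f : P →+ Q →+ M)
    (balanced : ∀ p s q, f (NUBimodule.ract (s : S) p) q = f p (NUBimodule.lact s q)) :
    NUTensor S P Q →+ M :=
  QuotientAddGroup.lift _
    (TensorProduct.liftAddHom (R := ℤ) f fun r p q => by
      rw [map_zsmul, map_zsmul, AddMonoidHom.zsmul_apply]) <| by
    rw [AddSubgroup.closure_le]
    rintro _ ⟨p, s, q, rfl⟩
    rw [SetLike.mem_coe, AddMonoidHom.mem_ker, map_sub, TensorProduct.liftAddHom_tmul,
      TensorProduct.liftAddHom_tmul, balanced, sub_self]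

theorem exists_fin_sum_of_mem_mul {A : Type*} [NonUnitalRing A] {M N : AddSubgroup A} {a : A}
    (ha : a ∈ M * N) : ∃ (n : ℕ) (x : Fin n → M) (y : Fin n → N), a = ∑ i, (x i : A) * y i := by
  refine AddSubmonoid.mul_induction_on ha
    (fun x hx y hy => ⟨1, fun _ => ⟨x, hx⟩, fun _ => ⟨y, hy⟩, by simp⟩) ?_
  rintro _ _ ⟨m, x, y, rfl⟩ ⟨n, x', y', rfl⟩
  exact ⟨m + n, Fin.append x x', Fin.append y y', by simp [Fin.sum_univ_add]⟩

namespace RingSystem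

variable {A : Type*} [NonUnitalRing A] (𝒜 : ℤ → AddSubgroup A)

/-- Elements of `A₁ A₋₁` serve as left units on finite subsets of `A₁` and as right units on finite
subsets of `A₋₁`. -/
structure HasLocalUnits : Prop where
  exists_left_unit : ∀ F : Finset (𝒜 1), ∃ u ∈ 𝒜 1 * 𝒜 (-1), ∀ x ∈ F, u * (x : A) = x
  exists_right_unit : ∀ F : Finset (𝒜 (-1)), ∃ u ∈ 𝒜 1 * 𝒜 (-1), ∀ y ∈ F, (y : A) * u = y

variable {𝒜} in
theorem exists_mul_eq_self (h𝒜 : HasLocalUnits 𝒜) {a : A} (ha : a ∈ 𝒜 1 * 𝒜 (-1)) :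
    ∃ u ∈ 𝒜 1 * 𝒜 (-1), a * u = a := by
  classical
  obtain ⟨n, q, p, rfl⟩ := exists_fin_sum_of_mem_mul ha
  obtain ⟨u, hu, h⟩ := h𝒜.exists_right_unit (Finset.univ.image p)
  refine ⟨u, hu, ?_⟩
  rw [Finset.sum_mul]
  exact Finset.sum_congr rfl fun i _ => by
    rw [mul_assoc, h (p i) (Finset.mem_image_of_mem p (Finset.mem_univ i))]

variable {𝒜} in
theorem mul_eq_zero_of_mem_mul {a u : A} (hu : u ∈ 𝒜 1 * 𝒜 (-1)) (h : ∀ x ∈ 𝒜 1, a * x = 0) :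
    a * u = 0 := by
  obtain ⟨n, q, p, rfl⟩ := exists_fin_sum_of_mem_mul hu
  rw [Finset.mul_sum]
  exact Finset.sum_eq_zero fun i _ => by rw [← mul_assoc, h _ (q i).2, zero_mul]

variable {𝒜} in
theorem eq_zero_of_mem_mul (h𝒜 : HasLocalUnits 𝒜) {a : A} (ha : a ∈ 𝒜 1 * 𝒜 (-1))
    (h : ∀ x ∈ 𝒜 1, a * x = 0) : a = 0 := by
  obtain ⟨u, hu, hau⟩ := exists_mul_eq_self h𝒜 ha
  rw [← hau, mul_eq_zero_of_mem_mul hu h]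

variable [SetLike.GradedMul 𝒜]

/-- The degree zero component of a graded ring, as a subring. -/
def zeroComponent : NonUnitalSubring A :=
  { 𝒜 0 with
    mul_mem' := fun {a b} (ha : a ∈ 𝒜 0) (hb : b ∈ 𝒜 0) => by
      change a * b ∈ 𝒜 0
      simpa only [add_zero] using SetLike.GradedMul.mul_mem ha hb }

/-- The multiplication of homogeneous elements as a biadditive map. -/
def componentMul {m n k : ℤ} (h : m + n = k) : 𝒜 m →+ 𝒜 n →+ 𝒜 k :=
  AddMonoidHom.mk' (fun a => AddMonoidHom.mk'
    (fun b => ⟨a * b, h ▸ SetLike.GradedMul.mul_mem a.2 b.2⟩) fun _ _ =>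
      Subtype.ext (mul_add _ _ _))
    fun _ _ => AddMonoidHom.ext fun _ => Subtype.ext (add_mul _ _ _)

instance (n : ℤ) : NUBimodule (zeroComponent 𝒜) (𝒜 n) where
  lact := componentMul 𝒜 (zero_add n)
  ract := (componentMul 𝒜 (add_zero n)).flip
  mul_lact _ _ _ := Subtype.ext (mul_assoc _ _ _)
  mul_ract _ _ _ := Subtype.ext (mul_assoc _ _ _).symm
  lact_ract _ _ _ := Subtype.ext (mul_assoc _ _ _).symm

/-- The system `(A₋₁, A₁, ψ)` over the ring `A₀`, with `ψ` the multiplication, that belongs to the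
`ℤ`-graded ring `A`. -/
def ofGrading : RingSystem (zeroComponent 𝒜) where
  P := 𝒜 (-1)
  Q := 𝒜 1
  ψ := NUTensor.lift (componentMul 𝒜 (neg_add_cancel 1)) fun _ _ _ =>
    Subtype.ext (mul_assoc _ _ _)
  ψ_lact _ _ _ := Subtype.ext (mul_assoc _ _ _)
  ψ_ract _ _ _ := Subtype.ext (mul_assoc _ _ _).symm

variable {𝒜}

theorem mem_zeroComponent_of_mem_mul {a : A} (ha : a ∈ 𝒜 1 * 𝒜 (-1)) : a ∈ zeroComponent 𝒜 :=
  AddSubmonoid.mul_induction_on ha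
    (fun x hx y hy => (componentMul 𝒜 (add_neg_cancel 1) ⟨x, hx⟩ ⟨y, hy⟩).2) fun _ _ => add_mem

theorem subtype_finRankQ {n : ℕ} (q : Fin n → 𝒜 1) (p : Fin n → 𝒜 (-1)) (x : 𝒜 1) :
    (𝒜 1).subtype ((ofGrading 𝒜).finRankQ q p x) = (∑ i, (q i : A) * p i) * x := by
  refine (map_sum (𝒜 1).subtype _ _).trans ?_
  rw [Finset.sum_mul]
  exact Finset.sum_congr rfl fun i _ => (mul_assoc _ _ _).symm

theorem subtype_finRankP {n : ℕ} (q : Fin n → 𝒜 1) (p : Fin n → 𝒜 (-1)) (y : 𝒜 (-1)) :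
    (𝒜 (-1)).subtype ((ofGrading 𝒜).finRankP q p y) = y * ∑ i, (q i : A) * p i := by
  refine (map_sum (𝒜 (-1)).subtype _ _).trans ?_
  rw [Finset.mul_sum]
  exact Finset.sum_congr rfl fun i _ => mul_assoc _ _ _

theorem isCompatible_ofGrading_iff {K : TwoSidedIdeal (zeroComponent 𝒜)} :
    (ofGrading 𝒜).IsCompatible K ↔
      ∀ a ∈ K, ∃ v ∈ 𝒜 1 * 𝒜 (-1), ∀ x ∈ 𝒜 1, (a : A) * x = v * x := by
  refine forall₂_congr fun a _ => ⟨?_, ?_⟩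
  · rintro ⟨n, (q : Fin n → 𝒜 1), (p : Fin n → 𝒜 (-1)), h⟩
    refine ⟨∑ i, (q i : A) * p i,
      sum_mem fun i _ => AddSubmonoid.mul_mem_mul (q i).2 (p i).2, fun x hx => ?_⟩
    exact (congrArg Subtype.val (h ⟨x, hx⟩)).trans (subtype_finRankQ q p ⟨x, hx⟩)
  · rintro ⟨v, hv, h⟩
    obtain ⟨n, q, p, rfl⟩ := exists_fin_sum_of_mem_mul hv
    exact ⟨n, q, p, fun x : 𝒜 1 => Subtype.ext <| (h x x.2).trans (subtype_finRankQ q p x).symm⟩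

theorem isFaithfulIdeal_ofGrading_iff {K : TwoSidedIdeal (zeroComponent 𝒜)} :
    (ofGrading 𝒜).IsFaithfulIdeal K ↔ ∀ a ∈ K, (∀ x ∈ 𝒜 1, (a : A) * x = 0) → a = 0 :=
  forall₂_congr fun _ _ => imp_congr_left
    ⟨fun h x hx => congrArg Subtype.val (h ⟨x, hx⟩), fun h (x : 𝒜 1) => Subtype.ext (h x x.2)⟩

variable (𝒜) in
/-- The ideal `A₁ A₋₁` of `A₀`. -/
def cpIdeal : TwoSidedIdeal (zeroComponent 𝒜) :=
  .mk' {a | (a : A) ∈ 𝒜 1 * 𝒜 (-1)} (zero_mem (𝒜 1 * 𝒜 (-1)))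
    (𝒜 1 * 𝒜 (-1)).add_mem (𝒜 1 * 𝒜 (-1)).neg_mem
    (fun {a b} hb => by
      refine AddSubmonoid.mul_induction_on hb (C := fun b => (a : A) * b ∈ 𝒜 1 * 𝒜 (-1)) ?_ ?_
      · intro x hx y hy
        rw [← mul_assoc]
        exact AddSubmonoid.mul_mem_mul (NUBimodule.lact a (⟨x, hx⟩ : 𝒜 1)).2 hy
      · intro x y hx hy
        rw [mul_add]
        exact add_mem hx hy)
    (fun {a b} ha => by
      refine AddSubmonoid.mul_induction_on ha (C := fun a => a * (b : A) ∈ 𝒜 1 * 𝒜 (-1)) ?_ ?_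
      · intro x hx y hy
        rw [mul_assoc]
        exact AddSubmonoid.mul_mem_mul hx (NUBimodule.ract b (⟨y, hy⟩ : 𝒜 (-1))).2
      · intro x y hx hy
        rw [add_mul]
        exact add_mem hx hy)

theorem mem_cpIdeal {a : zeroComponent 𝒜} : a ∈ cpIdeal 𝒜 ↔ (a : A) ∈ 𝒜 1 * 𝒜 (-1) :=
  TwoSidedIdeal.mem_mk' ..

theorem conditionFS_ofGrading (h𝒜 : HasLocalUnits 𝒜) : (ofGrading 𝒜).ConditionFS := by
  constructor
  · intro F
    obtain ⟨u, hu, h⟩ := h𝒜.exists_left_unit F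
    obtain ⟨n, q, p, rfl⟩ := exists_fin_sum_of_mem_mul hu
    exact ⟨n, q, p, fun x hx => Subtype.ext <| (subtype_finRankQ q p x).trans (h x hx)⟩
  · intro F
    obtain ⟨u, hu, h⟩ := h𝒜.exists_right_unit F
    obtain ⟨n, q, p, rfl⟩ := exists_fin_sum_of_mem_mul hu
    exact ⟨n, q, p, fun y hy => Subtype.ext <| (subtype_finRankP q p y).trans (h y hy)⟩

theorem isFaithfulIdeal_sup_cpIdeal (h𝒜 : HasLocalUnits 𝒜)
    {K : TwoSidedIdeal (zeroComponent 𝒜)} (hK : (ofGrading 𝒜).IsFaithfulIdeal K) :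
    (ofGrading 𝒜).IsFaithfulIdeal (K ⊔ cpIdeal 𝒜) := by
  refine isFaithfulIdeal_ofGrading_iff.2 fun a ha h => ?_
  obtain ⟨k, hk, z, hz, rfl⟩ := TwoSidedIdeal.mem_sup.1 ha
  obtain ⟨u, hu, hzu⟩ := exists_mul_eq_self h𝒜 (mem_cpIdeal.1 hz)
  have z_eq : z = -(k * ⟨u, mem_zeroComponent_of_mem_mul hu⟩) := by
    refine eq_neg_of_add_eq_zero_right (Subtype.ext ?_)
    calc (k * u + z : A) = (k + z) * u := by rw [add_mul, hzu]
      _ = 0 := mul_eq_zero_of_mem_mul hu h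
  exact isFaithfulIdeal_ofGrading_iff.1 hK _
    (K.add_mem hk (z_eq ▸ K.neg_mem (K.mul_mem_right _ _ hk))) h

theorem isCompatible_sup_cpIdeal {K : TwoSidedIdeal (zeroComponent 𝒜)}
    (hK : (ofGrading 𝒜).IsCompatible K) : (ofGrading 𝒜).IsCompatible (K ⊔ cpIdeal 𝒜) := by
  refine isCompatible_ofGrading_iff.2 fun a ha => ?_
  obtain ⟨k, hk, z, hz, rfl⟩ := TwoSidedIdeal.mem_sup.1 ha
  obtain ⟨v, hv, h⟩ := isCompatible_ofGrading_iff.1 hK k hk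
  refine ⟨v + z, add_mem hv (mem_cpIdeal.1 hz), fun x hx => ?_⟩
  rw [add_mul, ← h x hx, ← add_mul]
  rfl

theorem isCPIdeal_cpIdeal (h𝒜 : HasLocalUnits 𝒜)
    (maximal : ∀ K : TwoSidedIdeal (zeroComponent 𝒜), (ofGrading 𝒜).IsFaithfulIdeal K →
      (ofGrading 𝒜).IsCompatible K → cpIdeal 𝒜 ≤ K → K ≤ cpIdeal 𝒜) :
    (ofGrading 𝒜).IsCPIdeal (cpIdeal 𝒜) := by
  refine ⟨conditionFS_ofGrading h𝒜, ⟨isFaithfulIdeal_ofGrading_iff.2 fun a ha h => ?_,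
    isCompatible_ofGrading_iff.2 fun a ha => ?_⟩, fun K hK => ?_⟩
  · exact Subtype.ext (eq_zero_of_mem_mul h𝒜 (mem_cpIdeal.1 ha) h)
  · exact ⟨a, mem_cpIdeal.1 ha, fun _ _ => rfl⟩
  · exact le_sup_left.trans (maximal _ (isFaithfulIdeal_sup_cpIdeal h𝒜 hK.1)
      (isCompatible_sup_cpIdeal hK.2) le_sup_right)

theorem range_T_mul_range_U_le {B : Type*} [NonUnitalRing B]
    (ρ : (ofGrading 𝒜).InvariantRep (cpIdeal 𝒜) B) : ρ.T.range * ρ.U.range ≤ ρ.rangeσ :=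
  range_mul_range_le fun (q : 𝒜 1) (p : 𝒜 (-1)) => by
    refine ⟨componentMul 𝒜 (add_neg_cancel 1) q p, ?_⟩
    refine (ρ.σ_eq_sum _ (mem_cpIdeal.2 <| AddSubmonoid.mul_mem_mul q.2 p.2) 1 (fun _ => q)
      (fun _ => p) fun x : 𝒜 1 => Subtype.ext ?_).trans (Fintype.sum_unique _)
    refine Eq.trans ?_ (subtype_finRankQ (n := 1) (fun _ => q) (fun _ => p) x).symm
    rw [Fintype.sum_unique]
    rfl

/-- The representation of the system of `A` in `A` by the inclusions of the components. -/
def inclusionRep (h𝒜 : HasLocalUnits 𝒜) : (ofGrading 𝒜).InvariantRep (cpIdeal 𝒜) A where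
  σ := NonUnitalSubringClass.subtype (zeroComponent 𝒜)
  T := (𝒜 1).subtype
  U := (𝒜 (-1)).subtype
  T_lact _ _ := rfl
  T_ract _ _ := rfl
  U_lact _ _ := rfl
  U_ract _ _ := rfl
  σ_pair _ _ := rfl
  σ_eq_sum a ha n (q : Fin n → 𝒜 1) (p : Fin n → 𝒜 (-1)) h :=
    sub_eq_zero.1 <| eq_zero_of_mem_mul h𝒜
      (sub_mem (mem_cpIdeal.1 ha) (sum_mem fun i _ => AddSubmonoid.mul_mem_mul (q i).2 (p i).2))
      fun x hx => by
        rw [sub_mul, sub_eq_zero]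
        exact (congrArg Subtype.val (h (⟨x, hx⟩ : 𝒜 1))).trans (subtype_finRankQ q p ⟨x, hx⟩)

theorem gradedIsomorphic_ofGrading (h : IsIntGrading 𝒜) (h𝒜 : HasLocalUnits 𝒜)
    (closure_eq_top : NonUnitalSubring.closure (𝒜 0 ∪ 𝒜 1 ∪ 𝒜 (-1) : Set A) = ⊤) :
    GradedIsomorphic 𝒜 ((ofGrading 𝒜).grading (cpIdeal 𝒜)) := by
  obtain ⟨φ, hσ, hT, hU⟩ := (inclusionRep h𝒜).exists_lift
  have φ_gen_mem (x : (ofGrading 𝒜).Gen) : φ (.gen ℤ _ x) ∈ 𝒜 x.deg := by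
    rcases x with s | q | p
    · exact hσ s ▸ s.2
    · exact hT q ▸ q.2
    · exact hU p ▸ p.2
  refine gradedIsomorphic_of_surjective h (isIntGrading_grading _ _) φ (fun n b hb => ?_)
    (fun n b hb => ?_) ?_
  · refine PresentedAlgebra.component_le
      (𝒩 := fun n => { (𝒜 n).comap (φ : _ →+ A) with smul_mem' := fun r _ => int_smul_mem _ r })
      φ_gen_mem (fun x n a ha => ?_) n hb
    change φ (_ * a) ∈ 𝒜 _
    rw [map_mul]
    exact SetLike.GradedMul.mul_mem (φ_gen_mem x) ha
  · refine InvariantRep.eq_zero_of_mem_power (conditionFS_ofGrading h𝒜) (fun s hs => ?_) n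
      (grading_le_power (conditionFS_ofGrading h𝒜) (range_T_mul_range_U_le _) n hb)
    exact Subtype.ext ((hσ s).symm.trans hs)
  · rw [← NonUnitalRingHom.range_eq_top, ← top_le_iff, ← closure_eq_top,
      NonUnitalSubring.closure_le]
    rintro a ((ha | ha) | ha)
    · exact ⟨_, hσ ⟨a, ha⟩⟩
    · exact ⟨_, hT ⟨a, ha⟩⟩
    · exact ⟨_, hU ⟨a, ha⟩⟩

end RingSystem

/-! ### Representations of generalized Boolean dynamical systems -/

namespace GenBooleanDynSystem

variable {𝓑 : Type*} [GeneralizedBooleanAlgebra 𝓑] {Λ : Type*} {D : GenBooleanDynSystem 𝓑 Λ}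

/-- A family of elements of the ring `A` that satisfies the defining relations of
`L_R(𝓑, Λ, θ, 𝓘)`. -/
structure Representation (D : GenBooleanDynSystem 𝓑 Λ) (A : Type*) [NonUnitalRing A] where
  p : 𝓑 → A
  s : ∀ α, D.idl α → A
  sStar : ∀ α, D.idl α → A
  p_bot : p ⊥ = 0
  p_inf : ∀ B B', p (B ⊓ B') = p B * p B'
  p_sup : ∀ B B', p (B ⊔ B') = p B + p B' - p (B ⊓ B')
  p_mul_s : ∀ C α B, p C * s α B = s α B * p (D.θ α C)
  sStar_mul_p : ∀ C α B, sStar α B * p C = p (D.θ α C) * sStar α B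
  sStar_mul_s : ∀ α (B B' : D.idl α), sStar α B * s α B' = p ((B : 𝓑) ⊓ (B' : 𝓑))
  sStar_mul_s_of_ne : ∀ α α', α ≠ α' → ∀ (B : D.idl α) (B' : D.idl α'),
    sStar α B * s α' B' = 0
  s_mul_p : ∀ α B B', s α B * p B' = s α (D.cut B B')
  p_mul_sStar : ∀ α B B', p B' * sStar α B = sStar α (D.cut B B')
  p_regular : ∀ B, D.IsRegular B → ∀ F : Finset Λ, (F : Set Λ) = D.Δ B →
    p B = ∑ α ∈ F, s α (D.img α B) * sStar α (D.img α B)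

theorem Representation.exists_lift {R A : Type*} [CommRing R] [NonUnitalRing A] [Module R A]
    [IsScalarTower R A A] [SMulCommClass R A A] (ρ : D.Representation A) :
    ∃ φ : D.BooleanAlg R →ₙₐ[R] A, (∀ B, φ (PresentedAlgebra.gen R _ (.p B)) = ρ.p B) ∧
      (∀ α B, φ (PresentedAlgebra.gen R _ (.s α B)) = ρ.s α B) ∧
      ∀ α B, φ (PresentedAlgebra.gen R _ (.sStar α B)) = ρ.sStar α B := by
  have inr_sum (F : Finset Λ) (f : Λ → A) : ((∑ i ∈ F, f i : A) : Unitization R A) =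
      ∑ i ∈ F, (f i : Unitization R A) :=
    map_sum (Unitization.inrNonUnitalAlgHom R A) f F
  obtain ⟨φ, hφ, -⟩ := PresentedAlgebra.existsUnique_lift R (D.Rel R)
    (fun g : D.Gen => match g with
      | .p B => ρ.p B
      | .s α B => ρ.s α B
      | .sStar α B => ρ.sStar α B) (by
    intro a b h
    cases h <;> simp only [sF, sStarF, pF, map_add, map_sub, map_zero, map_mul, map_sum,
      FreeAlgebra.lift_ι_apply, ← Unitization.inr_add, ← Unitization.inr_mul,
      ← Unitization.inr_sub, ← Unitization.inr_zero, ← inr_sum, ρ.p_bot, ρ.p_inf, ρ.p_sup,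
      ρ.p_mul_s, ρ.sStar_mul_p, ρ.sStar_mul_s, ρ.s_mul_p, ρ.p_mul_sStar]
    case sStar_mul_s_of_ne h B B' => rw [ρ.sStar_mul_s_of_ne _ _ h]
    case p_regular B hB F hF => rw [ρ.p_regular B hB F hF])
  exact ⟨φ, fun B => hφ (.p B), fun α B => hφ (.s α B), fun α B => hφ (.sStar α B)⟩

variable (R : Type*) [CommRing R] (D)

open PresentedAlgebra in
/-- The universal representation of `D`. -/
noncomputable def universalRep : D.Representation (D.BooleanAlg R) :=
  have eq_of_rel {a b : FreeAlgebra R D.Gen} (h : D.Rel R a b) := RingQuot.mkAlgHom_rel R h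
  { p A := gen R _ (.p A)
    s α B := gen R _ (.s α B)
    sStar α B := gen R _ (.sStar α B)
    p_bot := incl_injective <| (eq_of_rel .p_bot).trans (map_zero _)
    p_inf A A' := incl_injective <| (eq_of_rel (.p_inf A A')).trans (map_mul _ _ _)
    p_sup A A' := incl_injective <| (eq_of_rel (.p_sup A A')).trans <| by
      rw [map_sub, map_add]
      rfl
    p_mul_s A α B := incl_injective <| (map_mul _ _ _).symm.trans <|
      (eq_of_rel (.p_mul_s A α B)).trans (map_mul _ _ _)
    sStar_mul_p A α B := incl_injective <| (map_mul _ _ _).symm.trans <|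
      (eq_of_rel (.sStar_mul_p A α B)).trans (map_mul _ _ _)
    sStar_mul_s α B B' := incl_injective <| (map_mul _ _ _).symm.trans <|
      eq_of_rel (.sStar_mul_s α B B')
    sStar_mul_s_of_ne α α' h B B' := incl_injective <| (map_mul _ _ _).symm.trans <|
      (eq_of_rel (.sStar_mul_s_of_ne α α' h B B')).trans (map_zero _)
    s_mul_p α B B' := incl_injective <| (map_mul _ _ _).symm.trans <|
      eq_of_rel (.s_mul_p α B B')
    p_mul_sStar α B B' := incl_injective <| (map_mul _ _ _).symm.trans <|
      eq_of_rel (.p_mul_sStar α B B')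
    p_regular A hA F hF := incl_injective <| (eq_of_rel (.p_regular A hA F hF)).trans <| by
      simp only [map_sum, map_mul]
      rfl }

instance : SetLike.GradedMul (D.grading R) where
  mul_mem _ _ _ _ := PresentedAlgebra.mul_mem_component

open PresentedAlgebra in
theorem isIntGrading_grading : IsIntGrading (D.grading R) := by
  refine isIntGrading_component fun a b h => ?_
  cases h with
  | p_bot => exact ⟨_, ι_mem_freeComponent _ rfl, zero_mem _⟩
  | p_inf => exact ⟨_, ι_mem_freeComponent _ rfl, ι_mul_ι_mem_freeComponent _ _ rfl⟩
  | p_sup => exact ⟨_, ι_mem_freeComponent _ rfl, sub_mem (add_mem (ι_mem_freeComponent _ rfl)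
      (ι_mem_freeComponent _ rfl)) (ι_mem_freeComponent _ rfl)⟩
  | p_mul_s | sStar_mul_p =>
    exact ⟨_, ι_mul_ι_mem_freeComponent _ _ rfl, ι_mul_ι_mem_freeComponent _ _ rfl⟩
  | sStar_mul_s | s_mul_p | p_mul_sStar =>
    exact ⟨_, ι_mul_ι_mem_freeComponent _ _ rfl, ι_mem_freeComponent _ rfl⟩
  | sStar_mul_s_of_ne => exact ⟨_, ι_mul_ι_mem_freeComponent _ _ rfl, zero_mem _⟩
  | p_regular =>
    exact ⟨_, ι_mem_freeComponent _ rfl, sum_mem fun i _ => ι_mul_ι_mem_freeComponent _ _ rfl⟩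

end GenBooleanDynSystem

/-! ### Boundary paths -/

namespace GenBooleanDynSystem

variable {𝓑 : Type*} [GeneralizedBooleanAlgebra 𝓑] {Λ : Type*} {D : GenBooleanDynSystem 𝓑 Λ}

/-- `η` is (the membership predicate of) a prime filter of `𝓑`, or empty. -/
structure IsCharacter (η : 𝓑 → Prop) : Prop where
  not_bot : ¬ η ⊥
  inf_iff : ∀ A B, η (A ⊓ B) ↔ η A ∧ η B
  sup_iff : ∀ A B, η (A ⊔ B) ↔ η A ∨ η B

open Order in
theorem IsCharacter.exists_ge {G : 𝓑 → Prop} (nonempty : ∃ A, G A)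
    (inf : ∀ A B, G A → G B → G (A ⊓ B)) (not_bot : ¬ G ⊥) :
    ∃ η, IsCharacter η ∧ ∀ A, G A → η A := by
  let F : PFilter 𝓑 := IsPFilter.toPFilter (F := {A | ∃ B, G B ∧ B ≤ A}) <| by
    refine IsPFilter.of_def ?_ ?_ ?_
    · obtain ⟨A, hA⟩ := nonempty
      exact ⟨A, A, hA, le_rfl⟩
    · rintro A ⟨A', hA', hA⟩ B ⟨B', hB', hB⟩
      exact ⟨A ⊓ B, ⟨A' ⊓ B', inf _ _ hA' hB', inf_le_inf hA hB⟩, inf_le_left, inf_le_right⟩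
    · rintro A B hAB ⟨C, hC, hCA⟩
      exact ⟨C, hC, hCA.trans hAB⟩
  have disjoint_bot : Disjoint (F : Set 𝓑) (Ideal.principal (⊥ : 𝓑) : Ideal 𝓑) := by
    rw [Set.disjoint_left]
    rintro A ⟨B, hB, hBA⟩ hA
    exact not_bot (le_bot_iff.1 (hBA.trans (Ideal.mem_principal.1 hA)) ▸ hB)
  obtain ⟨J, hJ, -, hFJ⟩ := DistribLattice.prime_ideal_of_disjoint_filter_ideal disjoint_bot
  refine ⟨fun A => A ∉ J, ⟨fun h => h J.bot_mem, fun A B => ?_, fun A B => ?_⟩,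
    fun A hA => Set.disjoint_left.1 hFJ ⟨A, hA, le_rfl⟩⟩
  · rw [← not_or, not_iff_not]
    exact ⟨hJ.mem_or_mem, Or.rec (J.lower inf_le_left) (J.lower inf_le_right)⟩
  · rw [Ideal.sup_mem_iff, not_and_or]

namespace IsCharacter

variable {η η' : 𝓑 → Prop}

theorem ne_bot (hη : IsCharacter η) {A : 𝓑} (hA : η A) : A ≠ ⊥ := by
  rintro rfl
  exact hη.not_bot hA

theorem comp_θ (hη : IsCharacter η) (α : Λ) : IsCharacter fun A => η (D.θ α A) where
  not_bot := by simpa only [D.map_bot] using hη.not_bot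
  inf_iff A B := by simpa only [map_inf] using hη.inf_iff _ _
  sup_iff A B := by simpa only [map_sup] using hη.sup_iff _ _

theorem sdiff (hη : IsCharacter η) {A B : 𝓑} (hA : η A) (hB : ¬ η B) : η (A \ B) := by
  rw [← sup_inf_sdiff A B, hη.sup_iff, hη.inf_iff] at hA
  exact hA.resolve_left fun h => hB h.2

theorem exists_le {ι : Type*} (hη : IsCharacter η) {A : 𝓑} (hA : η A) (F : Finset ι) {C : ι → 𝓑}
    (hC : ∀ i, η (C i)) : ∃ E ≤ A, η E ∧ ∀ i ∈ F, E ≤ C i := by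
  induction F using Finset.cons_induction with
  | empty => exact ⟨A, le_rfl, hA, by simp⟩
  | cons i F hi ih =>
    obtain ⟨E, hEA, hE, h⟩ := ih
    exact ⟨E ⊓ C i, inf_le_left.trans hEA, (hη.inf_iff _ _).2 ⟨hE, hC i⟩,
      (Finset.forall_mem_cons hi _).2 ⟨inf_le_right, fun j hj => inf_le_left.trans (h j hj)⟩⟩

/-- If `θ_α(C) = ⊥` for all `α` and suitable `C = C_α` in `η`, then the intersection of `A` with
the finitely many `C_α`, `α ∈ Δ_A`, has no letter. -/
theorem exists_forall_θ_ne_bot (hη : IsCharacter η) {A : 𝓑} (hA : D.IsRegular A) (hηA : η A) :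
    ∃ α, ∀ C, η C → D.θ α C ≠ ⊥ := by
  by_contra! h
  choose C hC θ_eq_bot using h
  have finite_Δ := (hA A le_rfl (hη.ne_bot hηA)).2
  obtain ⟨E, hEA, hE, hEC⟩ := hη.exists_le hηA finite_Δ.toFinset hC
  obtain ⟨α, hα⟩ := (hA E hEA (hη.ne_bot hE)).1
  have mem_Δ : α ∈ D.Δ A := ne_bot_of_le_ne_bot hα (OrderHomClass.mono (D.θ α) hEA)
  exact ne_bot_of_le_ne_bot hα (OrderHomClass.mono (D.θ α) (hEC α (finite_Δ.mem_toFinset.2 mem_Δ)))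
    (θ_eq_bot α)

theorem iff_θ (hη : IsCharacter η) (hη' : IsCharacter η') {α : Λ}
    (h : ∀ C, η C → η' (D.θ α C)) {A : 𝓑} (hA : η A) (B : 𝓑) : η B ↔ η' (D.θ α B) := by
  refine ⟨h B, fun hB => ?_⟩
  by_contra hB'
  apply hη'.not_bot
  rw [← D.map_bot α, ← inf_sdiff_self_right (x := B) (y := A), map_inf]
  exact (hη'.inf_iff _ _).2 ⟨hB, h _ (hη.sdiff hA hB')⟩

theorem exists_next (hη : IsCharacter η) {A : 𝓑} (hA : D.IsRegular A) (hηA : η A) :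
    ∃ α η', IsCharacter η' ∧ (∀ B, η B ↔ η' (D.θ α B)) ∧ ∃ B ∈ D.idl α, η' B := by
  obtain ⟨α, hα⟩ := hη.exists_forall_θ_ne_bot hA hηA
  obtain ⟨η', hη', h⟩ := exists_ge (G := fun B => ∃ C, η C ∧ D.θ α C = B) ⟨_, A, hηA, rfl⟩
    (by
      rintro _ _ ⟨C, hC, rfl⟩ ⟨C', hC', rfl⟩
      exact ⟨C ⊓ C', (hη.inf_iff _ _).2 ⟨hC, hC'⟩, map_inf _ _ _⟩)
    fun ⟨C, hC, h⟩ => hα C hC h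
  have θ_mem (C : 𝓑) (hC : η C) : η' (D.θ α C) := h _ ⟨C, hC, rfl⟩
  exact ⟨α, η', hη', hη.iff_θ hη' θ_mem hηA, _, (D.img α A).2, θ_mem A hηA⟩

end IsCharacter

/-- A sequence `(η₀, α₁, η₁, α₂, …)` of characters and letters in which `ηₙ` is the pullback of
`ηₙ₊₁` along the letter between them. A path may end (no letter) only at a character without regular
elements; what follows a missing letter is irrelevant. -/
@[ext]
structure BoundaryPath (D : GenBooleanDynSystem 𝓑 Λ) where
  char : ℕ → 𝓑 → Prop
  letter : ℕ → Option Λ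
  isCharacter : ∀ n, IsCharacter (char n)
  step : ∀ n α, letter n = some α → (∀ A, char n A ↔ char (n + 1) (D.θ α A)) ∧
    ∃ B ∈ D.idl α, char (n + 1) B
  halt : ∀ n, letter n = none → ∀ A, D.IsRegular A → ¬ char n A

namespace BoundaryPath

theorem exists_char_zero_eq {η : 𝓑 → Prop} (hη : IsCharacter η) :
    ∃ x : D.BoundaryPath, x.char 0 = η := by
  have exists_next (η : {η : 𝓑 → Prop // IsCharacter η}) :
      ∃ y : Option Λ × {η : 𝓑 → Prop // IsCharacter η},
        (∀ α, y.1 = some α → (∀ A, η.1 A ↔ y.2.1 (D.θ α A)) ∧ ∃ B ∈ D.idl α, y.2.1 B) ∧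
          (y.1 = none → ∀ A, D.IsRegular A → ¬ η.1 A) := by
    by_cases h : ∃ A, D.IsRegular A ∧ η.1 A
    · obtain ⟨A, hA, hηA⟩ := h
      obtain ⟨α, η', hη', h⟩ := η.2.exists_next hA hηA
      exact ⟨(some α, ⟨η', hη'⟩), fun _ hβ => Option.some_injective _ hβ ▸ h, nofun⟩
    · exact ⟨(none, η), nofun, fun _ A hA hηA => h ⟨A, hA, hηA⟩⟩
  choose f step halt using exists_next
  exact ⟨{ char n := ((fun η => (f η).2)^[n] ⟨η, hη⟩).1
           letter n := (f ((fun η => (f η).2)^[n] ⟨η, hη⟩)).1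
           isCharacter n := ((fun η => (f η).2)^[n] ⟨η, hη⟩).2
           step n α h := by
             rw [Function.iterate_succ_apply']
             exact step _ α h
           halt n h := halt _ h }, rfl⟩

/-- The path without its first character and letter. -/
def tail (x : D.BoundaryPath) : D.BoundaryPath where
  char n := x.char (n + 1)
  letter n := x.letter (n + 1)
  isCharacter n := x.isCharacter (n + 1)
  step n := x.step (n + 1)
  halt n := x.halt (n + 1)

/-- The path `x` preceded by the letter `α`. -/
def cons (α : Λ) (x : D.BoundaryPath) (h : ∃ B ∈ D.idl α, x.char 0 B) : D.BoundaryPath where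
  char n := Nat.casesOn n (fun A => x.char 0 (D.θ α A)) x.char
  letter n := Nat.casesOn n (some α) x.letter
  isCharacter
    | 0 => (x.isCharacter 0).comp_θ α
    | n + 1 => x.isCharacter n
  step
    | 0, _, rfl => ⟨fun _ => Iff.rfl, h⟩
    | n + 1, α, h => x.step n α h
  halt
    | n + 1, h => x.halt n h

@[simp]
theorem tail_cons (α : Λ) (x : D.BoundaryPath) (h) : (cons α x h).tail = x := rfl

@[simp]
theorem letter_cons (α : Λ) (x : D.BoundaryPath) (h) : (cons α x h).letter 0 = some α := rfl

@[simp]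
theorem char_cons (α : Λ) (x : D.BoundaryPath) (h) (A : 𝓑) :
    (cons α x h).char 0 A ↔ x.char 0 (D.θ α A) := Iff.rfl

theorem char_iff {x : D.BoundaryPath} {α : Λ} (h : x.letter 0 = some α) (A : 𝓑) :
    x.char 0 A ↔ x.tail.char 0 (D.θ α A) := (x.step 0 α h).1 A

theorem cons_tail {x : D.BoundaryPath} {α : Λ} (h : x.letter 0 = some α) :
    cons α x.tail (x.step 0 α h).2 = x := by
  refine BoundaryPath.ext (funext fun n => ?_) (funext fun n => ?_)
  · cases n with
    | zero => exact funext fun A => propext (char_iff h A).symm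
    | succ n => rfl
  · cases n with
    | zero => exact h.symm
    | succ n => rfl

variable (R : Type*) [CommRing R] (D)

open scoped Classical in
/-- The action of `p_A` on functions of boundary paths: the restriction to the paths that start in
`A`. -/
noncomputable def pOp (A : 𝓑) : Module.End R (D.BoundaryPath → R) where
  toFun f x := if x.char 0 A then f x else 0
  map_add' f g := by ext x; simp only [Pi.add_apply]; split_ifs <;> simp
  map_smul' r f := by ext x; simp

open scoped Classical in
/-- The action of `s_{α,B}` on functions of boundary paths: the composition with the removal of the
letter `α` in front of a path that starts in `B`. -/
noncomputable def sOp (α : Λ) (B : D.idl α) : Module.End R (D.BoundaryPath → R) where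
  toFun f x := if x.letter 0 = some α ∧ x.tail.char 0 B then f x.tail else 0
  map_add' f g := by ext x; simp only [Pi.add_apply]; split_ifs <;> simp
  map_smul' r f := by ext x; simp

open scoped Classical in
/-- The action of `s*_{α,B}` on functions of boundary paths: the composition with the addition of
the letter `α` in front of a path that starts in `B`. -/
noncomputable def sStarOp (α : Λ) (B : D.idl α) : Module.End R (D.BoundaryPath → R) where
  toFun f x := if h : x.char 0 B then f (cons α x ⟨B, B.2, h⟩) else 0
  map_add' f g := by ext x; simp only [Pi.add_apply]; split_ifs <;> simp
  map_smul' r f := by ext x; simp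

variable {D R}

open scoped Classical in
@[simp]
theorem pOp_apply (A : 𝓑) (f : D.BoundaryPath → R) (x : D.BoundaryPath) :
    pOp D R A f x = if x.char 0 A then f x else 0 := rfl

open scoped Classical in
@[simp]
theorem sOp_apply (α : Λ) (B : D.idl α) (f : D.BoundaryPath → R) (x : D.BoundaryPath) :
    sOp D R α B f x = if x.letter 0 = some α ∧ x.tail.char 0 B then f x.tail else 0 := rfl

open scoped Classical in
@[simp]
theorem sStarOp_apply (α : Λ) (B : D.idl α) (f : D.BoundaryPath → R) (x : D.BoundaryPath) :
    sStarOp D R α B f x = if h : x.char 0 B then f (cons α x ⟨B, B.2, h⟩) else 0 := rfl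

theorem sOp_sStarOp_apply_of_letter {α : Λ} (A : 𝓑) (f : D.BoundaryPath → R) {x : D.BoundaryPath}
    (h : x.letter 0 = some α) :
    sOp D R α (D.img α A) (sStarOp D R α (D.img α A) f) x = pOp D R A f x := by
  by_cases hA : x.char 0 A
  · have img_mem : x.tail.char 0 (D.img α A) := (char_iff h A).1 hA
    simp [h, hA, img_mem, cons_tail h]
  · have img_not_mem : ¬ x.tail.char 0 (D.img α A) := fun h' => hA ((char_iff h A).2 h')
    simp [hA, img_not_mem]

theorem pOp_regular {A : 𝓑} (hA : D.IsRegular A) {F : Finset Λ} (hF : (F : Set Λ) = D.Δ A) :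
    pOp D R A = ∑ α ∈ F, sOp D R α (D.img α A) * sStarOp D R α (D.img α A) := by
  ext f x
  simp only [LinearMap.sum_apply, Finset.sum_apply, Module.End.mul_apply]
  obtain h | ⟨α, hα⟩ := (x.letter 0).eq_none_or_eq_some
  · simp [h, x.halt 0 h A hA]
  · refine Eq.symm <| (Finset.sum_eq_single α (fun β _ hβ => ?_) fun hαF => ?_).trans
      (sOp_sStarOp_apply_of_letter A f hα)
    · simp [hα, hβ.symm]
    · have θ_eq_bot : D.θ α A = ⊥ := by
        by_contra h
        exact hαF (Finset.mem_coe.1 (hF ▸ h))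
      have not_mem : ¬ x.char 0 A := fun h =>
        (x.tail.isCharacter 0).not_bot (θ_eq_bot ▸ (char_iff hα A).1 h)
      rw [sOp_sStarOp_apply_of_letter A f hα, pOp_apply, if_neg not_mem]

variable (D R)

open scoped Classical in
/-- The representation of `D` on functions of boundary paths. -/
noncomputable def rep : D.Representation (Module.End R (D.BoundaryPath → R)) where
  p := pOp D R
  s := sOp D R
  sStar := sStarOp D R
  p_bot := by ext f x; simp [(x.isCharacter 0).not_bot]
  p_inf A B := by ext f x; simp [(x.isCharacter 0).inf_iff, ite_and]
  p_sup A B := by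
    ext f x
    by_cases hA : x.char 0 A <;> by_cases hB : x.char 0 B <;>
      simp [(x.isCharacter 0).inf_iff, (x.isCharacter 0).sup_iff, hA, hB]
  p_mul_s A α B := by
    ext f x
    by_cases h : x.letter 0 = some α
    · simp [h, char_iff h, ← ite_and, and_comm]
    · simp [h]
  sStar_mul_p A α B := by
    ext f x
    by_cases hB : x.char 0 B <;> simp [hB]
  sStar_mul_s α B B' := by
    ext f x
    by_cases hB : x.char 0 B <;> simp [hB, (x.isCharacter 0).inf_iff]
  sStar_mul_s_of_ne α α' h B B' := by ext f x; simp [h]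
  s_mul_p α B B' := by
    ext f x
    simp [cut, (x.tail.isCharacter 0).inf_iff, ← ite_and, and_assoc]
  p_mul_sStar α B B' := by
    ext f x
    by_cases hB' : x.char 0 B' <;> simp [cut, (x.isCharacter 0).inf_iff, hB']
  p_regular A hA F hF := pOp_regular hA hF

end BoundaryPath

theorem smul_p_ne_zero {R : Type*} [CommRing R] (D : GenBooleanDynSystem 𝓑 Λ) {r : R} (hr : r ≠ 0)
    {A : 𝓑} (hA : A ≠ ⊥) : r • (D.universalRep R).p A ≠ 0 := by
  obtain ⟨η, hη, h⟩ := IsCharacter.exists_ge (G := (· = A)) ⟨A, rfl⟩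
    (by rintro _ _ rfl rfl; exact inf_idem _) hA.symm
  obtain ⟨x, rfl⟩ := BoundaryPath.exists_char_zero_eq (D := D) hη
  obtain ⟨φ, hφ, -, -⟩ := (BoundaryPath.rep D R).exists_lift (R := R)
  intro h0
  apply hr
  calc r = (r • BoundaryPath.pOp D R A) 1 x := by simp [h A rfl]
    _ = φ (r • (D.universalRep R).p A) 1 x := by
      rw [map_smul]
      exact congrArg (fun T => (r • T) 1 x) (hφ A).symm
    _ = 0 := by rw [h0, map_zero]; rfl

end GenBooleanDynSystem

/-! ### Normal forms and local units -/

open Filter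

theorem eventually_eq_of_mem_span {R M N ι : Type*} [Semiring R] [AddCommMonoid M]
    [AddCommMonoid N] [Module R M] [Module R N] {l : Filter ι} {f g : ι → M →ₗ[R] N} {s : Set M}
    (h : ∀ x ∈ s, ∀ᶠ i in l, f i x = g i x) {x : M} (hx : x ∈ Submodule.span R s) :
    ∀ᶠ i in l, f i x = g i x := by
  induction hx using Submodule.span_induction with
  | zero => simp
  | mem x hx => exact h x hx
  | add x y _ _ hx hy =>
    filter_upwards [hx, hy] with i hxi hyi
    rw [map_add, map_add, hxi, hyi]
  | smul r x _ hx =>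
    filter_upwards [hx] with i hxi
    rw [map_smul, map_smul, hxi]

theorem smul_mem_closure {R A : Type*} [NonUnitalRing A] [DistribSMul R A] [IsScalarTower R A A]
    {s : Set A} (hs : ∀ (r : R), ∀ x ∈ s, r • x ∈ s) (r : R) {x : A}
    (hx : x ∈ NonUnitalSubring.closure s) : r • x ∈ NonUnitalSubring.closure s := by
  induction hx using NonUnitalSubring.closure_induction with
  | mem x hx => exact NonUnitalSubring.subset_closure (hs r x hx)
  | zero => simp
  | add x y _ _ hx hy => exact smul_add r x y ▸ add_mem hx hy
  | neg x _ hx => exact smul_neg r x ▸ neg_mem hx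
  | mul x y _ hy hx _ => exact smul_mul_assoc r x y ▸ mul_mem hx hy

namespace GenBooleanDynSystem

variable {𝓑 : Type*} [GeneralizedBooleanAlgebra 𝓑] {Λ : Type*} {D : GenBooleanDynSystem 𝓑 Λ}

namespace Representation

variable {A : Type*} [NonUnitalRing A] (ρ : D.Representation A)

theorem p_mul_p_of_le {B C : 𝓑} (h : B ≤ C) : ρ.p C * ρ.p B = ρ.p B := by
  rw [← ρ.p_inf, inf_eq_right.2 h]

theorem p_sup_of_disjoint {B C : 𝓑} (h : Disjoint B C) : ρ.p (B ⊔ C) = ρ.p B + ρ.p C := by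
  rw [ρ.p_sup, h.eq_bot, ρ.p_bot, sub_zero]

theorem s_mul_p_self (α : Λ) (B : D.idl α) : ρ.s α B * ρ.p B = ρ.s α B := by
  rw [ρ.s_mul_p]
  exact congrArg _ (Subtype.ext (inf_idem (B : 𝓑)))

theorem p_mul_sStar_self (α : Λ) (B : D.idl α) : ρ.p B * ρ.sStar α B = ρ.sStar α B := by
  rw [ρ.p_mul_sStar]
  exact congrArg _ (Subtype.ext (inf_idem (B : 𝓑)))

theorem p_mul_s_img (α : Λ) (C : 𝓑) : ρ.p C * ρ.s α (D.img α C) = ρ.s α (D.img α C) := by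
  rw [ρ.p_mul_s]
  exact ρ.s_mul_p_self α (D.img α C)

/-- The products `s_{α₁,B₁} ⋯ s_{αₘ,Bₘ} p_B`. -/
inductive IsPath : ℕ → A → Prop
  | p (B : 𝓑) : IsPath 0 (ρ.p B)
  | s_mul (α : Λ) (B : D.idl α) {m : ℕ} {a : A} : IsPath m a → IsPath (m + 1) (ρ.s α B * a)

/-- The products `p_B s*_{αₖ,Bₖ} ⋯ s*_{α₁,B₁}`. -/
inductive IsCopath : ℕ → A → Prop
  | p (B : 𝓑) : IsCopath 0 (ρ.p B)
  | mul_sStar (α : Λ) (B : D.idl α) {k : ℕ} {b : A} :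
      IsCopath k b → IsCopath (k + 1) (b * ρ.sStar α B)

variable {ρ}

theorem IsPath.p_mul {m : ℕ} {a : A} (ha : ρ.IsPath m a) (C : 𝓑) : ρ.IsPath m (ρ.p C * a) := by
  induction ha generalizing C with
  | p B => exact ρ.p_inf C B ▸ .p _
  | s_mul α B _ ih =>
    rw [← mul_assoc, ρ.p_mul_s, mul_assoc]
    exact .s_mul α B (ih _)

theorem IsCopath.p_mul {k : ℕ} {b : A} (hb : ρ.IsCopath k b) (C : 𝓑) :
    ρ.IsCopath k (ρ.p C * b) := by
  induction hb with
  | p B => exact ρ.p_inf C B ▸ .p _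
  | mul_sStar α B _ ih => exact mul_assoc (ρ.p C) _ _ ▸ ih.mul_sStar α B

theorem isPath_s (α : Λ) (B : D.idl α) : ρ.IsPath 1 (ρ.s α B) :=
  ρ.s_mul_p_self α B ▸ .s_mul α B (.p (B : 𝓑))

theorem isCopath_sStar (α : Λ) (B : D.idl α) : ρ.IsCopath 1 (ρ.sStar α B) :=
  ρ.p_mul_sStar_self α B ▸ .mul_sStar α B (.p (B : 𝓑))

theorem IsCopath.sStar_mul {k : ℕ} {b : A} (hb : ρ.IsCopath k b) (α : Λ) (B : D.idl α) :
    ρ.IsCopath (k + 1) (ρ.sStar α B * b) := by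
  induction hb with
  | p C => exact ρ.sStar_mul_p C α B ▸ (isCopath_sStar α B).p_mul _
  | mul_sStar β C _ ih => exact mul_assoc (ρ.sStar α B) _ _ ▸ ih.mul_sStar β C

variable {R : Type*} [Semiring R] [Module R A]

variable (R ρ) in
/-- The span of the monomials `s_{α₁,B₁} ⋯ s_{αₘ,Bₘ} p_B p_C s*_{βₖ,Cₖ} ⋯ s*_{β₁,C₁}` with
`m - k = n`. -/
def monomialSpan (n : ℤ) : Submodule R A :=
  .span R {a | ∃ m k x y, ρ.IsPath m x ∧ ρ.IsCopath k y ∧ (m - k : ℤ) = n ∧ a = x * y}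

theorem mul_mem_monomialSpan {m k : ℕ} {n : ℤ} {x y : A} (hx : ρ.IsPath m x)
    (hy : ρ.IsCopath k y) (h : (m - k : ℤ) = n) : x * y ∈ ρ.monomialSpan R n :=
  Submodule.subset_span ⟨m, k, x, y, hx, hy, h, rfl⟩

theorem monomialSpan_one_le :
    ρ.monomialSpan R 1 ≤ .span R {a | ∃ α B c, a = ρ.s α B * c} := by
  refine Submodule.span_le.2 ?_
  rintro _ ⟨m, k, x, y, hx, -, h, rfl⟩
  cases hx with
  | p C => push_cast at h; omega
  | @s_mul α B m x _ => exact Submodule.subset_span ⟨α, B, x * y, mul_assoc _ _ _⟩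

theorem monomialSpan_neg_one_le :
    ρ.monomialSpan R (-1) ≤ .span R {a | ∃ α B c, a = c * ρ.sStar α B} := by
  refine Submodule.span_le.2 ?_
  rintro _ ⟨m, k, x, y, -, hy, h, rfl⟩
  cases hy with
  | p C => push_cast at h; omega
  | @mul_sStar α B m y _ => exact Submodule.subset_span ⟨α, B, x * y, (mul_assoc _ _ _).symm⟩

theorem mul_mem_monomialSpan_of_forall [SMulCommClass R A A] {g : A} {d n : ℤ}
    (hg : ∀ (m k : ℕ) (x y : A), ρ.IsPath m x → ρ.IsCopath k y → (m - k : ℤ) = n →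
      g * (x * y) ∈ ρ.monomialSpan R (d + n))
    {a : A} (ha : a ∈ ρ.monomialSpan R n) : g * a ∈ ρ.monomialSpan R (d + n) := by
  suffices ρ.monomialSpan R n ≤ (ρ.monomialSpan R (d + n)).comap (LinearMap.mulLeft R g) from
    this ha
  refine Submodule.span_le.2 ?_
  rintro _ ⟨m, k, x, y, hx, hy, h, rfl⟩
  exact hg m k x y hx hy h

theorem p_mul_mem_monomialSpan [SMulCommClass R A A] (C : 𝓑) {n : ℤ} {a : A}
    (ha : a ∈ ρ.monomialSpan R n) : ρ.p C * a ∈ ρ.monomialSpan R (0 + n) :=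
  mul_mem_monomialSpan_of_forall (fun m k x y hx hy h => by
    rw [← mul_assoc]
    exact mul_mem_monomialSpan (hx.p_mul C) hy (by omega)) ha

theorem s_mul_mem_monomialSpan [SMulCommClass R A A] (α : Λ) (B : D.idl α) {n : ℤ} {a : A}
    (ha : a ∈ ρ.monomialSpan R n) : ρ.s α B * a ∈ ρ.monomialSpan R (1 + n) :=
  mul_mem_monomialSpan_of_forall (fun m k x y hx hy h => by
    rw [← mul_assoc]
    exact mul_mem_monomialSpan (hx.s_mul α B) hy (by push_cast; omega)) ha

theorem sStar_mul_mem_monomialSpan [SMulCommClass R A A] (α : Λ) (B : D.idl α) {n : ℤ} {a : A}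
    (ha : a ∈ ρ.monomialSpan R n) : ρ.sStar α B * a ∈ ρ.monomialSpan R (-1 + n) := by
  refine mul_mem_monomialSpan_of_forall (fun m k x y hx hy h => ?_) ha
  cases hx with
  | p C =>
    rw [← mul_assoc, ρ.sStar_mul_p, mul_assoc]
    exact mul_mem_monomialSpan (.p _) (hy.sStar_mul α B) (by push_cast; omega)
  | @s_mul β C m x hx =>
    rcases eq_or_ne α β with rfl | hne
    · rw [← mul_assoc, ← mul_assoc, ρ.sStar_mul_s]
      exact mul_mem_monomialSpan (hx.p_mul _) hy (by push_cast at h; omega)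
    · rw [← mul_assoc, ← mul_assoc, ρ.sStar_mul_s_of_ne _ _ hne, zero_mul, zero_mul]
      exact zero_mem _

variable (ρ) in
/-- The element `∑ s_{α,B_α} s*_{α,B_α}` for a finite set of letters `α` and a choice of the
`B_α`. -/
def localUnit (i : Finset Λ × (∀ α, D.idl α)) : A :=
  ∑ α ∈ i.1, ρ.s α (i.2 α) * ρ.sStar α (i.2 α)

theorem localUnit_mul_s {i : Finset Λ × (∀ α, D.idl α)} {α : Λ} {B : D.idl α} (hα : α ∈ i.1)
    (hB : B ≤ i.2 α) : ρ.localUnit i * ρ.s α B = ρ.s α B := by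
  rw [localUnit, Finset.sum_mul, Finset.sum_eq_single_of_mem α hα]
  · rw [mul_assoc, ρ.sStar_mul_s, inf_eq_right.2 hB, ρ.s_mul_p]
    exact congrArg _ (Subtype.ext (inf_eq_right.2 hB))
  · intro β _ hβ
    rw [mul_assoc, ρ.sStar_mul_s_of_ne _ _ hβ, mul_zero]

theorem sStar_mul_localUnit {i : Finset Λ × (∀ α, D.idl α)} {α : Λ} {B : D.idl α} (hα : α ∈ i.1)
    (hB : B ≤ i.2 α) : ρ.sStar α B * ρ.localUnit i = ρ.sStar α B := by
  rw [localUnit, Finset.mul_sum, Finset.sum_eq_single_of_mem α hα]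
  · rw [← mul_assoc, ρ.sStar_mul_s, inf_eq_left.2 hB, ρ.p_mul_sStar]
    exact congrArg _ (Subtype.ext (inf_eq_right.2 hB))
  · intro β _ hβ
    rw [← mul_assoc, ρ.sStar_mul_s_of_ne _ _ hβ.symm, zero_mul]

end Representation

instance : Nonempty (Finset Λ × (∀ α, D.idl α)) :=
  ⟨(∅, fun α => ⟨⊥, (D.idl α).bot_mem⟩)⟩

instance : IsDirectedOrder (Finset Λ × (∀ α, D.idl α)) := by
  classical
  exact ⟨fun i j => ⟨(i.1 ∪ j.1, fun α => ⟨i.2 α ⊔ j.2 α, (D.idl α).sup_mem (i.2 α).2 (j.2 α).2⟩),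
    ⟨Finset.subset_union_left, fun _ => le_sup_left (α := 𝓑)⟩,
    ⟨Finset.subset_union_right, fun _ => le_sup_right (α := 𝓑)⟩⟩⟩

theorem eventually_mem_and_le (α : Λ) (B : D.idl α) :
    ∀ᶠ i : Finset Λ × (∀ α, D.idl α) in atTop, α ∈ i.1 ∧ B ≤ i.2 α := by
  classical
  refine eventually_atTop.2 ⟨({α}, Function.update (fun α => ⟨⊥, (D.idl α).bot_mem⟩) α B), ?_⟩
  rintro ⟨F, b⟩ ⟨hF, hb⟩
  exact ⟨hF (Finset.mem_singleton_self α), by simpa using hb α⟩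

variable {R : Type*} [CommRing R]

theorem p_mem_grading (B : 𝓑) : (D.universalRep R).p B ∈ D.grading R 0 :=
  PresentedAlgebra.gen_mem_component Gen.deg (.p B)

theorem s_mem_grading (α : Λ) (B : D.idl α) : (D.universalRep R).s α B ∈ D.grading R 1 :=
  PresentedAlgebra.gen_mem_component Gen.deg (.s α B)

theorem sStar_mem_grading (α : Λ) (B : D.idl α) :
    (D.universalRep R).sStar α B ∈ D.grading R (-1) :=
  PresentedAlgebra.gen_mem_component Gen.deg (.sStar α B)

theorem smul_mem_grading {n : ℤ} (r : R) {a : D.BooleanAlg R} (ha : a ∈ D.grading R n) :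
    r • a ∈ D.grading R n :=
  PresentedAlgebra.smul_mem_component r ha

theorem s_mul_sStar_mem (α : Λ) (B C : D.idl α) :
    (D.universalRep R).s α B * (D.universalRep R).sStar α C ∈ D.grading R 1 * D.grading R (-1) :=
  AddSubmonoid.mul_mem_mul (s_mem_grading α B) (sStar_mem_grading α C)

theorem grading_le_monomialSpan (n : ℤ) :
    D.grading R n ≤ ((D.universalRep R).monomialSpan R n).toAddSubgroup := by
  refine PresentedAlgebra.component_le (fun g => ?_) (fun g n a ha => ?_) n
  · rcases g with B | ⟨α, B⟩ | ⟨α, B⟩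
    · have := Representation.mul_mem_monomialSpan (R := R) (n := 0)
        (ρ := D.universalRep R) (.p B) (.p B) rfl
      rwa [Representation.p_mul_p_of_le _ le_rfl] at this
    · have := Representation.mul_mem_monomialSpan (R := R) (n := 1)
        (Representation.isPath_s (ρ := D.universalRep R) α B) (.p (B : 𝓑)) rfl
      rwa [Representation.s_mul_p_self] at this
    · have := Representation.mul_mem_monomialSpan (R := R) (n := -1) (.p (B : 𝓑))
        (Representation.isCopath_sStar (ρ := D.universalRep R) α B) rfl
      rwa [Representation.p_mul_sStar_self] at this
  · rcases g with B | ⟨α, B⟩ | ⟨α, B⟩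
    · exact Representation.p_mul_mem_monomialSpan B ha
    · exact Representation.s_mul_mem_monomialSpan α B ha
    · exact Representation.sStar_mul_mem_monomialSpan α B ha

theorem mem_span_of_mem_grading_one {x : D.BooleanAlg R} (hx : x ∈ D.grading R 1) :
    x ∈ Submodule.span R {a | ∃ α B c, a = (D.universalRep R).s α B * c} :=
  Representation.monomialSpan_one_le (grading_le_monomialSpan 1 hx)

theorem mem_span_of_mem_grading_neg_one {y : D.BooleanAlg R} (hy : y ∈ D.grading R (-1)) :
    y ∈ Submodule.span R {a | ∃ α B c, a = c * (D.universalRep R).sStar α B} :=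
  Representation.monomialSpan_neg_one_le (grading_le_monomialSpan (-1) hy)

theorem Representation.IsPath.mem_grading {m : ℕ} {x : D.BooleanAlg R}
    (hx : (D.universalRep R).IsPath m x) : x ∈ D.grading R m := by
  induction hx with
  | p B => exact p_mem_grading B
  | @s_mul α B m x _ ih =>
    rw [show ((m + 1 : ℕ) : ℤ) = 1 + m by push_cast; ring]
    exact SetLike.mul_mem_graded (s_mem_grading α B) ih

theorem Representation.IsCopath.mem_grading {k : ℕ} {y : D.BooleanAlg R}
    (hy : (D.universalRep R).IsCopath k y) : y ∈ D.grading R (-k) := by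
  induction hy with
  | p B => exact p_mem_grading B
  | @mul_sStar α B k y _ ih =>
    rw [show (-(k + 1 : ℕ) : ℤ) = -k + -1 by push_cast; ring]
    exact SetLike.mul_mem_graded ih (sStar_mem_grading α B)

theorem smul_mem_grading_mul {m n : ℤ} (r : R) {a : D.BooleanAlg R}
    (ha : a ∈ D.grading R m * D.grading R n) : r • a ∈ D.grading R m * D.grading R n := by
  obtain ⟨n, x, y, rfl⟩ := exists_fin_sum_of_mem_mul ha
  rw [Finset.smul_sum]
  exact sum_mem fun i _ => smul_mul_assoc r (x i : D.BooleanAlg R) _ ▸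
    AddSubmonoid.mul_mem_mul (smul_mem_grading r (x i).2) (y i).2

theorem exists_add_of_mem_grading_zero {a : D.BooleanAlg R} (ha : a ∈ D.grading R 0) :
    ∃ b ∈ Submodule.span R (Set.range (D.universalRep R).p),
      ∃ c ∈ D.grading R 1 * D.grading R (-1), a = b + c := by
  replace ha : a ∈ (D.universalRep R).monomialSpan R 0 := grading_le_monomialSpan 0 ha
  induction ha using Submodule.span_induction with
  | zero => exact ⟨0, zero_mem _, 0, zero_mem _, (add_zero 0).symm⟩
  | add _ _ _ _ ha ha' =>
    obtain ⟨b, hb, c, hc, rfl⟩ := ha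
    obtain ⟨b', hb', c', hc', rfl⟩ := ha'
    exact ⟨b + b', add_mem hb hb', c + c', add_mem hc hc', add_add_add_comm b c b' c'⟩
  | smul r _ _ ha =>
    obtain ⟨b, hb, c, hc, rfl⟩ := ha
    exact ⟨r • b, Submodule.smul_mem _ r hb, r • c, smul_mem_grading_mul r hc, smul_add r b c⟩
  | mem a ha =>
    obtain ⟨m, k, x, y, hx, hy, h, rfl⟩ := ha
    cases hx with
    | p B =>
      cases hy with
      | p C => exact ⟨_, Submodule.subset_span ⟨B ⊓ C, (D.universalRep R).p_inf B C⟩, 0,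
          zero_mem _, (add_zero _).symm⟩
      | mul_sStar => push_cast at h; omega
    | @s_mul α B m x hx =>
      refine ⟨0, zero_mem _, _, ?_, (zero_add _).symm⟩
      rw [mul_assoc]
      refine AddSubmonoid.mul_mem_mul (s_mem_grading α B) ?_
      rw [show (-1 : ℤ) = m + -k by push_cast at h; omega]
      exact SetLike.mul_mem_graded hx.mem_grading hy.mem_grading

theorem hasLocalUnits_grading : RingSystem.HasLocalUnits (D.grading R) := by
  have localUnit_mem (i : Finset Λ × (∀ α, D.idl α)) :
      (D.universalRep R).localUnit i ∈ D.grading R 1 * D.grading R (-1) :=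
    sum_mem fun α _ => s_mul_sStar_mem α _ _
  constructor
  · intro F
    have h : ∀ᶠ i in atTop, ∀ x ∈ F, (D.universalRep R).localUnit i * x = x :=
      (eventually_all_finset F).2 fun x _ => eventually_eq_of_mem_span
        (f := fun i => LinearMap.mulLeft R ((D.universalRep R).localUnit i))
        (g := fun _ => LinearMap.id) (by
          rintro _ ⟨α, B, c, rfl⟩
          filter_upwards [eventually_mem_and_le α B] with i hi
          simp only [LinearMap.mulLeft_apply, LinearMap.id_apply, ← mul_assoc,
            Representation.localUnit_mul_s hi.1 hi.2]) (mem_span_of_mem_grading_one x.2)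
    obtain ⟨i, hi⟩ := h.exists
    exact ⟨_, localUnit_mem i, hi⟩
  · intro F
    have h : ∀ᶠ i in atTop, ∀ y ∈ F, y * (D.universalRep R).localUnit i = y :=
      (eventually_all_finset F).2 fun y _ => eventually_eq_of_mem_span
        (f := fun i => LinearMap.mulRight R ((D.universalRep R).localUnit i))
        (g := fun _ => LinearMap.id) (by
          rintro _ ⟨α, B, c, rfl⟩
          filter_upwards [eventually_mem_and_le α B] with i hi
          simp only [LinearMap.mulRight_apply, LinearMap.id_apply, mul_assoc,
            Representation.sStar_mul_localUnit hi.1 hi.2]) (mem_span_of_mem_grading_neg_one y.2)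
    obtain ⟨i, hi⟩ := h.exists
    exact ⟨_, localUnit_mem i, hi⟩

theorem closure_grading_eq_top : NonUnitalSubring.closure
    (D.grading R 0 ∪ D.grading R 1 ∪ D.grading R (-1) : Set (D.BooleanAlg R)) = ⊤ := by
  let L : NonUnitalSubalgebra R (D.BooleanAlg R) :=
    { NonUnitalSubring.closure
        (D.grading R 0 ∪ D.grading R 1 ∪ D.grading R (-1) : Set (D.BooleanAlg R)) with
      smul_mem' := smul_mem_closure fun r x hx => hx.imp (Or.imp (smul_mem_grading r)
        (smul_mem_grading r)) (smul_mem_grading r) }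
  have adjoin_le :
      NonUnitalAlgebra.adjoin R (Set.range (PresentedAlgebra.gen R (D.Rel R))) ≤ L := by
    refine NonUnitalAlgebra.adjoin_le ?_
    rintro _ ⟨B | ⟨α, B⟩ | ⟨α, B⟩, rfl⟩ <;> refine NonUnitalSubring.subset_closure ?_
    · exact .inl (.inl (p_mem_grading B))
    · exact .inl (.inr (s_mem_grading α B))
    · exact .inr (sStar_mem_grading α B)
  rw [PresentedAlgebra.adjoin_range_gen] at adjoin_le
  exact top_le_iff.1 fun a _ => adjoin_le (NonUnitalAlgebra.mem_top : a ∈ ⊤)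

end GenBooleanDynSystem

/-! ### Maximality of the ideal `A₁ A₋₁` -/

theorem forall_of_forall_le_or_disjoint {α : Type*} [GeneralizedBooleanAlgebra α]
    {motive : α → Prop}
    (sup : ∀ A B, Disjoint A B → motive A → motive B → motive (A ⊔ B)) (F : Finset α)
    (h : ∀ B, (∀ A ∈ F, B ≤ A ∨ Disjoint B A) → motive B) (B : α) : motive B := by
  classical
  induction F using Finset.induction_on generalizing B with
  | empty => exact h B (by simp)
  | insert A F _ ih =>
    refine ih (fun B hB => ?_) B
    have of_le {C : α} (hC : C ≤ B) (hCA : C ≤ A ∨ Disjoint C A) : motive C :=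
      h C <| Finset.forall_mem_insert _ _ _ |>.2
        ⟨hCA, fun A hA => (hB A hA).imp hC.trans (Disjoint.mono_left hC)⟩
    rw [← sup_inf_sdiff B A]
    exact sup _ _ disjoint_inf_sdiff (of_le inf_le_left (.inl inf_le_right))
      (of_le sdiff_le (.inr disjoint_sdiff_self_left))

namespace GenBooleanDynSystem

variable {𝓑 : Type*} [GeneralizedBooleanAlgebra 𝓑] {Λ : Type*} {D : GenBooleanDynSystem 𝓑 Λ}

namespace Representation

variable {R A : Type*} [Semiring R] [NonUnitalRing A] [Module R A] [SMulCommClass R A A]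
  (ρ : D.Representation A)

theorem exists_finset_p_mul_eq_smul {a : A} (ha : a ∈ Submodule.span R (Set.range ρ.p)) :
    ∃ F : Finset 𝓑, ∀ B, (∀ A ∈ F, B ≤ A ∨ Disjoint B A) → ∃ r : R, ρ.p B * a = r • ρ.p B := by
  classical
  induction ha using Submodule.span_induction with
  | zero => exact ⟨∅, fun B _ => ⟨0, by rw [mul_zero, zero_smul]⟩⟩
  | mem _ ha =>
    obtain ⟨A, rfl⟩ := ha
    refine ⟨{A}, fun B hB => ?_⟩
    rw [← ρ.p_inf]
    rcases hB A (Finset.mem_singleton_self A) with hBA | hBA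
    · exact ⟨1, by rw [inf_eq_left.2 hBA, one_smul]⟩
    · exact ⟨0, by rw [hBA.eq_bot, ρ.p_bot, zero_smul]⟩
  | add a b _ _ ha hb =>
    obtain ⟨F, hF⟩ := ha
    obtain ⟨G, hG⟩ := hb
    refine ⟨F ∪ G, fun B hB => ?_⟩
    obtain ⟨r, hr⟩ := hF B fun A hA => hB A (Finset.mem_union_left G hA)
    obtain ⟨t, ht⟩ := hG B fun A hA => hB A (Finset.mem_union_right F hA)
    exact ⟨r + t, by rw [mul_add, hr, ht, add_smul]⟩
  | smul r a _ ha =>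
    obtain ⟨F, hF⟩ := ha
    refine ⟨F, fun B hB => ?_⟩
    obtain ⟨t, ht⟩ := hF B hB
    exact ⟨r * t, by rw [mul_smul_comm, ht, mul_smul]⟩

theorem exists_p_mul_eq_self {a : A} (ha : a ∈ Submodule.span R (Set.range ρ.p)) :
    ∃ C, ρ.p C * a = a := by
  have : ∀ᶠ C in atTop, ρ.p C * a = a := eventually_eq_of_mem_span
    (f := fun C => LinearMap.mulLeft R (ρ.p C)) (g := fun _ => LinearMap.id) (by
      rintro _ ⟨B, rfl⟩
      filter_upwards [eventually_ge_atTop B] with C hC using ρ.p_mul_p_of_le hC) ha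
  exact this.exists

end Representation

variable {R : Type*} [CommRing R]

theorem p_mul_eq_zero_of_Δ_eq_empty {C : 𝓑} (hC : D.Δ C = ∅) {x : D.BooleanAlg R}
    (hx : x ∈ D.grading R 1) : (D.universalRep R).p C * x = 0 := by
  suffices Submodule.span R {a | ∃ α B c, a = (D.universalRep R).s α B * c} ≤
    LinearMap.ker (LinearMap.mulLeft R ((D.universalRep R).p C)) from
    this (mem_span_of_mem_grading_one hx)
  refine Submodule.span_le.2 ?_
  rintro _ ⟨α, B, c, rfl⟩
  have hα : D.θ α C = ⊥ := not_not.1 (Set.eq_empty_iff_forall_notMem.1 hC α)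
  change (D.universalRep R).p C * ((D.universalRep R).s α B * c) = 0
  rw [← mul_assoc, Representation.p_mul_s, hα, Representation.p_bot, mul_zero, zero_mul]

theorem eventually_mul_s_eq_zero {v : D.BooleanAlg R} (hv : v ∈ D.grading R 1 * D.grading R (-1))
    (B : ∀ α, D.idl α) : ∀ᶠ α in cofinite, v * (D.universalRep R).s α (B α) = 0 := by
  refine AddSubmonoid.mul_induction_on hv (fun x _ y hy => ?_) fun v w hv hw => ?_
  · have : ∀ᶠ α in cofinite, y * (D.universalRep R).s α (B α) = 0 := eventually_eq_of_mem_span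
      (f := fun α => LinearMap.mulRight R ((D.universalRep R).s α (B α))) (g := fun _ => 0) (by
        rintro _ ⟨β, C, c, rfl⟩
        filter_upwards [(Set.finite_singleton β).eventually_cofinite_notMem] with α hα
        rw [LinearMap.mulRight_apply, mul_assoc,
          Representation.sStar_mul_s_of_ne _ _ _ (Ne.symm hα), mul_zero, LinearMap.zero_apply])
      (mem_span_of_mem_grading_neg_one hy)
    filter_upwards [this] with α hα
    rw [mul_assoc, hα, mul_zero]
  · filter_upwards [hv, hw] with α hvα hwα
    rw [add_mul, hvα, hwα, add_zero]

theorem finite_Δ_of_smul_p_mul_eq {r : R} (hr : r ≠ 0) {C : 𝓑} {v : D.BooleanAlg R}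
    (hv : v ∈ D.grading R 1 * D.grading R (-1))
    (h : ∀ x ∈ D.grading R 1, r • (D.universalRep R).p C * x = v * x) : (D.Δ C).Finite := by
  refine (eventually_cofinite.1 (eventually_mul_s_eq_zero hv fun α => D.img α C)).subset ?_
  refine fun α hα hvα => smul_p_ne_zero D hr hα ?_
  calc r • (D.universalRep R).p (D.θ α C)
      = (D.universalRep R).sStar α (D.img α C) *
          (r • (D.universalRep R).p C * (D.universalRep R).s α (D.img α C)) := by
        rw [smul_mul_assoc, Representation.p_mul_s_img, mul_smul_comm,
          Representation.sStar_mul_s, inf_idem]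
        rfl
    _ = 0 := by rw [h _ (s_mem_grading α _), hvα, mul_zero]

theorem p_mem_of_isRegular {B : 𝓑} (hB : D.IsRegular B) :
    (D.universalRep R).p B ∈ D.grading R 1 * D.grading R (-1) := by
  rcases eq_or_ne B ⊥ with rfl | hB₀
  · rw [Representation.p_bot]
    exact zero_mem _
  · obtain ⟨F, hF⟩ := (hB B le_rfl hB₀).2.exists_finset_coe
    rw [(D.universalRep R).p_regular B hB F hF]
    exact sum_mem fun α _ => s_mul_sStar_mem α _ _

open RingSystem

variable {K : TwoSidedIdeal (zeroComponent (D.grading R))}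

theorem isRegular_of_smul_p_mem (faithful : (ofGrading (D.grading R)).IsFaithfulIdeal K)
    (compatible : (ofGrading (D.grading R)).IsCompatible K) {r : R} (hr : r ≠ 0) {B : 𝓑}
    {b : zeroComponent (D.grading R)} (hb : b ∈ K)
    (hbB : (b : D.BooleanAlg R) = r • (D.universalRep R).p B) : D.IsRegular B := by
  intro C hCB hC
  let c : zeroComponent (D.grading R) := ⟨(D.universalRep R).p C, p_mem_grading C⟩ * b
  have hcK : c ∈ K := K.mul_mem_left _ _ hb
  have hc : (c : D.BooleanAlg R) = r • (D.universalRep R).p C := by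
    change (D.universalRep R).p C * (b : D.BooleanAlg R) = _
    rw [hbB, mul_smul_comm, ← Representation.p_inf, inf_eq_left.2 hCB]
  constructor
  · by_contra hΔ
    have hc₀ : c = 0 := isFaithfulIdeal_ofGrading_iff.1 faithful c hcK fun x hx => by
      rw [hc, smul_mul_assoc,
        p_mul_eq_zero_of_Δ_eq_empty (Set.not_nonempty_iff_eq_empty.1 hΔ) hx, smul_zero]
    exact smul_p_ne_zero D hr hC (hc ▸ congrArg Subtype.val hc₀)
  · obtain ⟨v, hv, h⟩ := isCompatible_ofGrading_iff.1 compatible c hcK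
    exact finite_Δ_of_smul_p_mul_eq hr hv fun x hx => hc ▸ h x hx

theorem mem_of_mem_span_p (faithful : (ofGrading (D.grading R)).IsFaithfulIdeal K)
    (compatible : (ofGrading (D.grading R)).IsCompatible K)
    {a : zeroComponent (D.grading R)} (ha : a ∈ K)
    (hap : (a : D.BooleanAlg R) ∈ Submodule.span R (Set.range (D.universalRep R).p)) :
    (a : D.BooleanAlg R) ∈ D.grading R 1 * D.grading R (-1) := by
  obtain ⟨F, hF⟩ := (D.universalRep R).exists_finset_p_mul_eq_smul hap
  obtain ⟨C, hC⟩ := (D.universalRep R).exists_p_mul_eq_self hap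
  rw [← hC]
  refine forall_of_forall_le_or_disjoint
    (motive := fun C => (D.universalRep R).p C * a ∈ D.grading R 1 * D.grading R (-1))
    (fun A B hAB hA hB => ?_) F (fun B hB => ?_) C
  · rw [(D.universalRep R).p_sup_of_disjoint hAB, add_mul]
    exact add_mem hA hB
  · obtain ⟨r, hr⟩ := hF B hB
    rcases eq_or_ne r 0 with rfl | hr₀
    · rw [hr, zero_smul]
      exact zero_mem _
    · let p : zeroComponent (D.grading R) := ⟨(D.universalRep R).p B, p_mem_grading B⟩
      have hB : D.IsRegular B :=
        isRegular_of_smul_p_mem faithful compatible hr₀ (K.mul_mem_left p a ha) hr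
      exact hr ▸ smul_mem_grading_mul r (p_mem_of_isRegular hB)

theorem isCPIdeal_cpIdeal_grading :
    (ofGrading (D.grading R)).IsCPIdeal (cpIdeal (D.grading R)) := by
  refine isCPIdeal_cpIdeal hasLocalUnits_grading fun K faithful compatible hK a ha => ?_
  obtain ⟨b, hb, c, hc, hbc⟩ := exists_add_of_mem_grading_zero a.2
  let z : zeroComponent (D.grading R) := ⟨c, mem_zeroComponent_of_mem_mul hc⟩
  have hz : z ∈ cpIdeal (D.grading R) := mem_cpIdeal.2 hc
  have coe_sub : ((a - z : zeroComponent (D.grading R)) : D.BooleanAlg R) = b :=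
    sub_eq_of_eq_add hbc
  have hb' := mem_of_mem_span_p faithful compatible (K.sub_mem ha (hK hz)) (coe_sub ▸ hb)
  exact mem_cpIdeal.2 (hbc ▸ add_mem (coe_sub ▸ hb') hc)

end GenBooleanDynSystem

theorem mainTheorem3 {𝓑 : Type*} [GeneralizedBooleanAlgebra 𝓑] {Λ : Type*}
    (D : GenBooleanDynSystem 𝓑 Λ) (R : Type*) [CommRing R] :
    ∃ (S : NonUnitalSubring (D.BooleanAlg R)) (X : RingSystem S) (K : TwoSidedIdeal S),
      X.IsCPIdeal K ∧ GradedIsomorphic (D.grading R) (X.grading K) :=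
  ⟨RingSystem.zeroComponent (D.grading R), RingSystem.ofGrading (D.grading R),
    RingSystem.cpIdeal (D.grading R), GenBooleanDynSystem.isCPIdeal_cpIdeal_grading,
    RingSystem.gradedIsomorphic_ofGrading (GenBooleanDynSystem.isIntGrading_grading D R)
      GenBooleanDynSystem.hasLocalUnits_grading GenBooleanDynSystem.closure_grading_eq_top⟩
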